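/- Let $M$ be a matroid on a finite totally ordered set $E$. For $i\in E$ let $\le_i$ be the cyclically shifted order on $E$ that starts at $i$, and let $J_i(M)$ be the lexicographically minimal basis of $M$ with respect to $\le_i$; the family $\mathcal J(M)=(J_i(M))_{i\in E}$ is the Grassmann necklace of $M$. A positroid $P$ on $E$ is a matroid that is realized by a real matrix of full row rank, with columns indexed by $E$ in increasing order, all of whose maximal minors are nonnegative. Its envelope class $\Omega_P$ is the set of all matroids $M$ on the ordered set $E$ with $\mathcal J(M)=\mathcal J(P)$. For $r\ge 2$ let $\mathcal W_r$ be the wheel graph, obtained from a cycle of length $r$ (the rim; two parallel edges if $r=2$) by adding a vertex joined by one edge to each vertex of the cycle. Let $\mathcal N_r$ be the graph obtained by gluing, at one vertex, a cycle of length $r$ and a graph that consists of two vertices joined by $r$ parallel edges. Let $M(G)$ denote the cycle matroid of a graph $G$. The cycle of length $r$ is a circuit-hyperplane of $M(\mathcal W_r)$ and of $M(\mathcal N_r)$; the whirl $\mathcal W^r$ and the matroid $\mathcal N^r$ are the matroids obtained from $M(\mathcal W_r)$ and $M(\mathcal N_r)$, respectively, by relaxing it, that is, by adding the edge set of this cycle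 to the set of bases. **Theorem.** Let $r\ge 2$ and let $P$ be a positroid that is isomorphic, as a matroid, to $\mathcal W^r$. Then $\Omega_P$ has exactly four elements, and they can be listed as $M_1,M_2,M_3,M_4$ with $$M_1\cong M(\mathcal N_r),\qquad M_2\cong \mathcal N^r,\qquad M_3\cong M(\mathcal W_r),\qquad M_4\cong \mathcal W^r .$$ Moreover, if $r\ge 3$, then $M(\mathcal N_r)$, $\mathcal N^r$, $M(\mathcal W_r)$ and $\mathcal W^r$ are pairwise non-isomorphic, so that matroid isomorphism gives a bijection between $\Omega_P$ and the set of these four matroids. -/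

import Mathlib

/-! ### Matroid isomorphism, hyperplanes, circuit-hyperplane relaxation -/

/-- Two matroids are isomorphic if there is a bijection between their ground sets that
preserves bases in both directions. -/
def MatroidIso {α β : Type*} (M : Matroid α) (N : Matroid β) : Prop :=
  ∃ e : M.E ≃ N.E, ∀ B : Set M.E,
    M.IsBase (Subtype.val '' B) ↔ N.IsBase (Subtype.val '' (e '' B))

/-- A hyperplane is a flat whose rank is one less than the rank of the matroid. -/
def IsHyperplane {β : Type*} (M : Matroid β) (X : Set β) : Prop :=
  M.IsFlat X ∧ M.eRk X + 1 = M.eRank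

/-- A circuit-hyperplane is a set that is both a circuit and a hyperplane. -/
def IsCircuitHyperplane {β : Type*} (M : Matroid β) (X : Set β) : Prop :=
  M.IsCircuit X ∧ IsHyperplane M X

theorem relax_exchange {β : Type*} [Finite β] (M : Matroid β) (X : Set β) :
    Matroid.ExchangeProperty (fun B => M.IsBase B ∨ (IsCircuitHyperplane M X ∧ B = X)) := by
  rintro B₁ B₂ h₁ h₂ x hx
  have hcard : (B₁ \ {x}).encard + 1 = B₁.encard :=
    Set.encard_sdiff_singleton_add_one hx.1
  rcases h₁ with h₁ | ⟨hX, rfl⟩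
  · rcases h₂ with h₂ | ⟨hX, rfl⟩
    · obtain ⟨y, hy, hb⟩ := h₁.exchange h₂ hx
      exact ⟨y, hy, Or.inl hb⟩
    · obtain ⟨hC, hF, hr⟩ := hX
      have hI : M.Indep (B₁ \ {x}) := h₁.indep.subset Set.sdiff_subset
      by_cases hsub : B₁ \ {x} ⊆ B₂
      · have hne : B₁ \ {x} ≠ B₂ := by
          rintro h
          exact hC.not_indep (h ▸ hI)
        obtain ⟨y, hy, hyn⟩ := Set.exists_of_ssubset (hsub.ssubset_of_ne hne)
        have hyB : y ∉ B₁ := fun h => hyn ⟨h, fun h' => hx.2 (h' ▸ hy)⟩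
        refine ⟨y, ⟨hy, hyB⟩, Or.inr ⟨⟨hC, hF, hr⟩, ?_⟩⟩
        have hle : B₂.encard ≤ (insert y (B₁ \ {x})).encard := by
          rw [Set.encard_insert_of_notMem hyn, hcard, h₁.encard_eq_eRank, ← hr,
            hC.eRk_add_one_eq]
        exact Set.Finite.eq_of_subset_of_encard_le (Set.toFinite _)
          (Set.insert_subset hy hsub) hle
      · by_contra! hcon
        apply hsub
        have hcl : B₂ ⊆ M.closure (B₁ \ {x}) := by
          intro y hy
          by_contra hyc
          have hyE := hF.subset_ground hy
          have hyI : y ∉ B₁ \ {x} :=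
            fun h => hyc (M.mem_closure_of_mem h hI.subset_ground)
          have hyB : y ∉ B₁ := fun h => hyI ⟨h, fun h' => hx.2 (h' ▸ hy)⟩
          refine (hcon y ⟨hy, hyB⟩).1 (h₁.exchange_isBase_of_indep hyB ?_)
          exact (hI.notMem_closure_iff_of_notMem hyI).1 hyc
        obtain ⟨K, hK⟩ := M.exists_isBasis B₂
        have hKcl : K ⊆ M.closure (B₁ \ {x}) := hK.subset.trans hcl
        have hKc : K.encard = (B₁ \ {x}).encard := by
          have : K.encard + 1 = (B₁ \ {x}).encard + 1 := by
            rw [hcard, h₁.encard_eq_eRank, ← hr, hK.encard_eq_eRk]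
          exact ENat.add_left_injective_of_ne_top (n := 1) (by simp) this
        have hKb : M.IsBasis K (M.closure (B₁ \ {x})) := by
          have hb : M.IsBasis (B₁ \ {x}) (M.closure (B₁ \ {x})) := hI.isBasis_closure
          obtain ⟨L, hL, hKL⟩ := hK.indep.subset_isBasis_of_subset hKcl
          have : K = L := by
            refine Set.Finite.eq_of_subset_of_encard_le (Set.toFinite _) hKL ?_
            rw [hKc, hL.encard_eq_encard hb]
          exact this ▸ hL
        have := hF.subset_of_isBasis_of_isBasis hK hKb
        exact (M.subset_closure _ hI.subset_ground).trans this
  · rcases h₂ with h₂ | ⟨-, rfl⟩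
    · obtain ⟨hC, hF, hr⟩ := hX
      have hI : M.Indep (B₁ \ {x}) := hC.sdiff_singleton_indep hx.1
      have h2 : B₂.encard = B₁.encard := by
        rw [h₂.encard_eq_eRank, ← hr, hC.eRk_add_one_eq]
      have hlt : (B₁ \ {x}).encard < B₂.encard := by
        rw [h2, ← hcard]
        exact ENat.lt_add_one_iff (Set.encard_ne_top_iff.2 (Set.toFinite _)) |>.2 le_rfl
      obtain ⟨y, hy, hyI⟩ := hI.augment h₂.indep hlt
      have hyx : y ≠ x := fun h => hx.2 (h ▸ hy.1)
      have hyB : y ∉ B₁ := fun h => hy.2 ⟨h, hyx⟩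
      refine ⟨y, ⟨hy.1, hyB⟩, Or.inl (hyI.isBase_of_maximal fun J hJ hsub => ?_)⟩
      refine Set.Finite.eq_of_subset_of_encard_le (Set.toFinite _) hsub ?_
      rw [Set.encard_insert_of_notMem hy.2, hcard, ← h2, h₂.encard_eq_eRank]
      exact hJ.encard_le_eRank
    · exact absurd hx.1 hx.2

/-- The relaxation of a circuit-hyperplane `X` of `M`: the bases are those of `M`, together
with `X`. (If `X` is not a circuit-hyperplane of `M`, nothing is added.) -/
def relax {β : Type*} [Finite β] (M : Matroid β) (X : Set β) : Matroid β :=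
  Matroid.ofIsBaseOfFinite (E := M.E) (Set.toFinite _)
    (fun B => M.IsBase B ∨ (IsCircuitHyperplane M X ∧ B = X))
    (M.exists_isBase.imp fun _ h => Or.inl h) (relax_exchange M X)
    (by rintro B (h | ⟨h, rfl⟩); exacts [h.subset_ground, h.1.subset_ground])

/-! ### The cycle matroid of a finite multigraph -/

section Cycle

variable {V β : Type*}

/-- The vertices `x` and `y` are joined by a path of `G` all of whose edges lie in `F`. -/
def EdgeJoined (G : Graph V β) (F : Set β) (x y : V) : Prop :=
  Relation.ReflTransGen (G.restrict F).Adj x y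

/-- A set `F` of edges of `G` is a forest if no edge of `F` lies on a cycle with edges in `F`,
that is, if no edge of `F` has ends that are joined by a path in `F` avoiding that edge.
(In particular a forest contains no loops and no two parallel edges.) -/
def IsForest (G : Graph V β) (F : Set β) : Prop :=
  F ⊆ G.edgeSet ∧ ∀ e ∈ F, ∀ x y, G.IsLink e x y → ¬ EdgeJoined G (F \ {e}) x y

theorem EdgeJoined.mono {G : Graph V β} {F F' : Set β} (h : F ⊆ F') {x y : V}
    (hj : EdgeJoined G F x y) : EdgeJoined G F' x y := by
  refine Relation.ReflTransGen.mono (r := (G.restrict F).Adj) ?_ x y hj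
  rintro a b ⟨e, he⟩
  simp only [Graph.restrict_isLink] at he
  exact ⟨e, by simp only [Graph.restrict_isLink]; exact ⟨h he.1, he.2⟩⟩

theorem EdgeJoined.symm {G : Graph V β} {F : Set β} {x y : V}
    (hj : EdgeJoined G F x y) : EdgeJoined G F y x := by
  induction hj with
  | refl => exact Relation.ReflTransGen.refl
  | tail _ hbc ih => exact Relation.ReflTransGen.head hbc.symm ih

theorem EdgeJoined.of_link {G : Graph V β} {F : Set β} {x y : V} {e : β} (he : e ∈ F)
    (h : G.IsLink e x y) : EdgeJoined G F x y :=
  Relation.ReflTransGen.single ⟨e, by simp only [Graph.restrict_isLink]; exact ⟨he, h⟩⟩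

theorem EdgeJoined.of_spans {G : Graph V β} {F F' : Set β}
    (h : ∀ e ∈ F, ∀ x y, G.IsLink e x y → EdgeJoined G F' x y) {x y : V}
    (hj : EdgeJoined G F x y) : EdgeJoined G F' x y := by
  induction hj with
  | refl => exact Relation.ReflTransGen.refl
  | tail _ hbc ih =>
    obtain ⟨e, he⟩ := hbc
    simp only [Graph.restrict_isLink] at he
    exact ih.trans (h e he.1 _ _ he.2)

theorem EdgeJoined.insert_cases {G : Graph V β} {F : Set β} {f : β} {u v : V}
    (hf : G.IsLink f u v) {x y : V} (hj : EdgeJoined G (insert f F) x y) :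
    EdgeJoined G F x y ∨ (EdgeJoined G F x u ∧ EdgeJoined G F v y) ∨
      (EdgeJoined G F x v ∧ EdgeJoined G F u y) := by
  induction hj with
  | refl => exact Or.inl Relation.ReflTransGen.refl
  | @tail b c _ hbc ih =>
    obtain ⟨e, he⟩ := hbc
    simp only [Graph.restrict_isLink] at he
    rcases he.1 with rfl | heF
    · have h0 : EdgeJoined G F v v := Relation.ReflTransGen.refl
      have h1 : EdgeJoined G F u u := Relation.ReflTransGen.refl
      rcases hf.eq_and_eq_or_eq_and_eq he.2 with ⟨rfl, rfl⟩ | ⟨rfl, rfl⟩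
      · rcases ih with ih | ih | ih
        · exact Or.inr (Or.inl ⟨ih, h0⟩)
        · exact Or.inr (Or.inl ⟨ih.1, h0⟩)
        · exact Or.inl ih.1
      · rcases ih with ih | ih | ih
        · exact Or.inr (Or.inr ⟨ih, h1⟩)
        · exact Or.inl ih.1
        · exact Or.inr (Or.inr ⟨ih.1, h1⟩)
    · have hbc : EdgeJoined G F b c := EdgeJoined.of_link heF he.2
      rcases ih with ih | ih | ih
      · exact Or.inl (ih.trans hbc)
      · exact Or.inr (Or.inl ⟨ih.1, ih.2.trans hbc⟩)
      · exact Or.inr (Or.inr ⟨ih.1, ih.2.trans hbc⟩)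

theorem IsForest.subset {G : Graph V β} {I J : Set β} (hJ : IsForest G J) (h : I ⊆ J) :
    IsForest G I :=
  ⟨h.trans hJ.1, fun e he x y hl hj =>
    hJ.2 e (h he) x y hl (hj.mono (Set.sdiff_subset_sdiff_left h))⟩

theorem IsForest.insert {G : Graph V β} {I : Set β} (hI : IsForest G I) {f : β} {u v : V}
    (hf : G.IsLink f u v) (hn : ¬ EdgeJoined G I u v) : IsForest G (insert f I) := by
  have hfI : f ∉ I := fun h => hn (EdgeJoined.of_link h hf)
  refine ⟨Set.insert_subset hf.edge_mem hI.1, ?_⟩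
  rintro g (rfl | hg) x y hl hj
  · have hj' : EdgeJoined G I x y := hj.mono (by
      rintro a ⟨rfl | ha, hne⟩
      · exact absurd rfl hne
      · exact ha)
    rcases hf.eq_and_eq_or_eq_and_eq hl with ⟨rfl, rfl⟩ | ⟨rfl, rfl⟩
    · exact hn hj'
    · exact hn hj'.symm
  · have hj' : EdgeJoined G (Insert.insert f (I \ {g})) x y := hj.mono (by
      rintro a ⟨rfl | ha, hne⟩
      · exact Or.inl rfl
      · exact Or.inr ⟨ha, hne⟩)
    have hsub : I \ {g} ⊆ I := Set.sdiff_subset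
    have hxy : EdgeJoined G I x y := EdgeJoined.of_link hg hl
    rcases hj'.insert_cases hf with h | h | h
    · exact hI.2 g hg x y hl h
    · exact hn (((h.1.mono hsub).symm.trans hxy).trans (h.2.mono hsub).symm)
    · exact hn ((h.2.mono hsub).trans (hxy.symm.trans (h.1.mono hsub)))

theorem IsForest.ncard_le [Finite β] {G : Graph V β} {I : Set β} (n : ℕ) :
    ∀ J : Set β, IsForest G J → (J \ I).ncard = n →
      (∀ e ∈ J, ∀ x y, G.IsLink e x y → EdgeJoined G I x y) → I ⊆ G.edgeSet →
      J.ncard ≤ I.ncard := by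
  induction n with
  | zero =>
    intro J _ h0 _ _
    have : J \ I = ∅ := (Set.ncard_eq_zero (Set.toFinite _)).1 h0
    exact Set.ncard_le_ncard (Set.sdiff_eq_empty.1 this) (Set.toFinite _)
  | succ n ih =>
    intro J hJ hn hspan hIE
    obtain ⟨f, hf⟩ : (J \ I).Nonempty := Set.nonempty_of_ncard_ne_zero (by omega)
    obtain ⟨x, y, hl⟩ := G.exists_isLink_of_mem_edgeSet (hJ.1 hf.1)
    have hnj := hJ.2 f hf.1 x y hl
    obtain ⟨g, hg, u, v, hgl, hgn⟩ :
        ∃ g ∈ I, ∃ u v, G.IsLink g u v ∧ ¬ EdgeJoined G (J \ {f}) u v := by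
      by_contra! hcon
      exact hnj ((hspan f hf.1 x y hl).of_spans hcon)
    have hgJ : g ∉ J \ {f} := fun h => hgn (EdgeJoined.of_link h hgl)
    have hJ' := (hJ.subset (Set.sdiff_subset (t := {f}))).insert hgl hgn
    have hc : (Insert.insert g (J \ {f})).ncard = J.ncard := by
      rw [Set.ncard_insert_of_notMem hgJ (Set.toFinite _),
        Set.ncard_sdiff_singleton_add_one hf.1 (Set.toFinite _)]
    have hd : Insert.insert g (J \ {f}) \ I = (J \ I) \ {f} := by
      ext a
      simp only [Set.mem_sdiff, Set.mem_insert_iff, Set.mem_singleton_iff]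
      constructor
      · rintro ⟨rfl | h, h'⟩
        · exact absurd hg h'
        · exact ⟨⟨h.1, h'⟩, h.2⟩
      · rintro ⟨⟨h, h'⟩, h''⟩
        exact ⟨Or.inr ⟨h, h''⟩, h'⟩
    rw [← hc]
    refine ih _ hJ' ?_ ?_ hIE
    · rw [hd, Set.ncard_sdiff_singleton_of_mem hf, hn]
      rfl
    · rintro e (rfl | he) a b hab
      · exact EdgeJoined.of_link hg hab
      · exact hspan e he.1 a b hab

/-- The cycle matroid of a multigraph with finitely many edges: the ground set is the edge set,
and a set of edges is independent if and only if it is a forest (so that the bases are the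
maximal forests). -/
def cycleMatroid [Finite β] (G : Graph V β) : Matroid β :=
  (IndepMatroid.ofFinite (E := G.edgeSet) (Set.toFinite _) (IsForest G)
    ⟨Set.empty_subset _, by simp⟩
    (fun _ _ hJ h => hJ.subset h)
    (by
      intro I J hI hJ hlt
      by_contra! hcon
      refine absurd (IsForest.ncard_le (I := I) _ J hJ rfl ?_ hI.1) (not_le.2 hlt)
      intro e he x y hl
      by_contra hn
      have heI : e ∉ I := fun h => hn (EdgeJoined.of_link h hl)
      exact hcon e he heI (hI.insert hl hn))
    (fun _ hI => hI.1)).matroid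

end Cycle

/-! ### Wheels, whirls, and the graphs `N_r` -/

/-- The multigraph on the vertex set `V` with edge set `β` in which the edge `e` has the two
ends `(ends e).1` and `(ends e).2`. -/
def graphOfEnds {V β : Type*} (ends : β → V × V) : Graph V β where
  vertexSet := Set.univ
  IsLink e x y := s(x, y) = s((ends e).1, (ends e).2)
  edgeSet := Set.univ
  isLink_symm e _ := ⟨fun x y h => by rw [Sym2.eq_swap]; exact h⟩
  eq_or_eq_of_isLink_of_isLink := by
    intro e x y v w h h'
    have := h.trans h'.symm
    rw [Sym2.eq_iff] at this
    tauto
  edge_mem_iff_exists_isLink e := by simp only [Set.mem_univ, true_iff]; exact ⟨_, _, rfl⟩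
  left_mem_of_isLink := by simp

/-- The wheel graph on `r + 1` vertices: `none` is the hub and the rim vertices are `some i`.
The edge `Sum.inl i` is the spoke joining the hub to `some i`, and the edge `Sum.inr i` is the
rim edge joining `some i` to `some (i + 1)`, indices modulo `r`. -/
def wheelGraph (r : ℕ) : Graph (Option (Fin r)) (Fin r ⊕ Fin r) :=
  graphOfEnds (Sum.elim (fun i => (none, some i)) (fun i => (some i, some (finRotate r i))))

/-- The graph `N_r`, a cycle of length `r` joined at a vertex to its planar dual (two vertices
joined by `r` parallel edges). The edge `Sum.inl i` is one of the `r` parallel edges, which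
join `none` to the vertex `some 0` of the cycle, and `Sum.inr i` is the edge of the cycle that
joins `some i` to `some (i + 1)`, indices modulo `r`. -/
def graphN (r : ℕ) : Graph (Option (Fin r)) (Fin r ⊕ Fin r) :=
  graphOfEnds (Sum.elim (fun i => (none, some ⟨0, i.pos⟩))
    (fun i => (some i, some (finRotate r i))))

/-- The edge set of the cycle of length `r`, both in the wheel (its rim) and in `N_r`. -/
def rim (r : ℕ) : Set (Fin r ⊕ Fin r) := Set.range Sum.inr

/-- The whirl of rank `r`. -/
def whirl (r : ℕ) : Matroid (Fin r ⊕ Fin r) := relax (cycleMatroid (wheelGraph r)) (rim r)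

/-- The relaxation of the cycle of length `r` in the cycle matroid of `N_r`. -/
def relaxedN (r : ℕ) : Matroid (Fin r ⊕ Fin r) := relax (cycleMatroid (graphN r)) (rim r)

/-! The cycle of length `r` is a circuit-hyperplane of the cycle matroids of both graphs, so that
the two relaxations above add exactly one basis. -/

theorem EdgeJoined.eq_of_isolated {V β : Type*} {G : Graph V β} {F : Set β} {x y : V}
    (h : ∀ e ∈ F, ∀ z, ¬ G.IsLink e z y) (hj : EdgeJoined G F x y) : x = y := by
  induction hj with
  | refl => rfl
  | tail _ hbc _ =>
    obtain ⟨e, he⟩ := hbc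
    simp only [Graph.restrict_isLink] at he
    exact absurd he.2 (h e he.1 _)

open Fin.CommRing Fin.NatCast in
theorem rim_isCircuitHyperplane_aux {n : ℕ} (f : Fin (n + 1) → Fin (n + 1)) :
    IsCircuitHyperplane (cycleMatroid (graphOfEnds
      (Sum.elim (fun i => (none, some (f i))) (fun i => (some i, some (finRotate (n + 1) i))))))
      (rim (n + 1)) := by
  set G : Graph (Option (Fin (n + 1))) (Fin (n + 1) ⊕ Fin (n + 1)) := graphOfEnds
      (Sum.elim (fun i => (none, some (f i)))
        (fun i => (some i, some (finRotate (n + 1) i)))) with hG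
  have hcast : ∀ j k : ℕ, j ≤ n → k ≤ n → ((j : Fin (n + 1)) = (k : Fin (n + 1))) → j = k := by
    intro j k hj hk h
    have := congrArg Fin.val h
    rwa [Fin.val_natCast, Fin.val_natCast, Nat.mod_eq_of_lt (by omega),
      Nat.mod_eq_of_lt (by omega)] at this
  have hn1 : ((n : Fin (n + 1)) + 1) = 0 := by
    have := Fin.natCast_self (n + 1)
    push_cast at this
    exact this
  have hrim : ∀ (i : Fin (n + 1)) x y, G.IsLink (Sum.inr i) x y ↔
      s(x, y) = s(some i, some (i + 1)) := by
    intro i x y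
    simp [hG, graphOfEnds]
  have hspoke : ∀ (i : Fin (n + 1)) x y, G.IsLink (Sum.inl i) x y ↔
      s(x, y) = s(none, some (f i)) := by
    intro i x y
    simp [hG, graphOfEnds]
  let P : Fin (n + 1) → ℕ → Set (Fin (n + 1) ⊕ Fin (n + 1)) :=
    fun e k => {a | ∃ j < k, a = Sum.inr (e + 1 + (j : Fin (n + 1)))}
  have hPsucc : ∀ e k, P e (k + 1) = insert (Sum.inr (e + 1 + (k : Fin (n + 1)))) (P e k) := by
    intro e k
    ext a
    simp only [P, Set.mem_ofPred_eq, Set.mem_insert_iff]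
    constructor
    · rintro ⟨j, hj, rfl⟩
      rcases Nat.lt_succ_iff_lt_or_eq.1 hj with h | rfl
      · exact Or.inr ⟨j, h, rfl⟩
      · exact Or.inl rfl
    · rintro (rfl | ⟨j, hj, rfl⟩)
      · exact ⟨k, Nat.lt_succ_self k, rfl⟩
      · exact ⟨j, by omega, rfl⟩
  have hPforest : ∀ e k, k ≤ n → IsForest G (P e k) := by
    intro e k
    induction k with
    | zero =>
      intro _
      have : P e 0 = ∅ := by ext a; simp [P]
      rw [this]
      exact ⟨Set.empty_subset _, by simp⟩
    | succ k ih =>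
      intro hk
      rw [hPsucc]
      refine (ih (by omega)).insert ((hrim _ _ _).2 rfl) ?_
      intro hj
      have := hj.eq_of_isolated (by
        rintro a ⟨j, hj, rfl⟩ z hl
        rw [hrim, Sym2.eq_iff] at hl
        rcases hl with ⟨-, hl⟩ | ⟨-, hl⟩
        · simp only [Option.some.injEq] at hl
          have h2 := hcast j (j + 1) (by omega) (by omega)
          have h3 : ((k + 1 : ℕ) : Fin (n + 1)) = ((j + 1 : ℕ) : Fin (n + 1)) := by
            push_cast
            simpa [add_assoc] using hl
          have := hcast _ _ (by omega) (by omega) h3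
          omega
        · simp only [Option.some.injEq] at hl
          have h3 : ((k + 1 : ℕ) : Fin (n + 1)) = (j : Fin (n + 1)) := by
            push_cast
            simpa [add_assoc] using hl
          have := hcast _ _ (by omega) (by omega) h3
          omega)
      simp only [Option.some.injEq] at this
      have h3 : (k : Fin (n + 1)) = ((k + 1 : ℕ) : Fin (n + 1)) := by
        push_cast
        simpa [add_assoc] using this
      have := hcast _ _ (by omega) (by omega) h3
      omega
  have hcover : ∀ e x : Fin (n + 1), ∃ j ≤ n, x = e + 1 + (j : Fin (n + 1)) := by
    intro e x
    refine ⟨(x - (e + 1)).val, Nat.lt_succ_iff.1 (x - (e + 1)).isLt, ?_⟩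
    rw [Fin.cast_val_eq_self]
    abel
  have hPn : ∀ e, P e n = rim (n + 1) \ {Sum.inr e} := by
    intro e
    ext a
    constructor
    · rintro ⟨j, hj, rfl⟩
      refine ⟨⟨_, rfl⟩, ?_⟩
      intro h
      simp only [Set.mem_singleton_iff, Sum.inr.injEq] at h
      have h4 : ((j : Fin (n + 1)) + 1) = (n : Fin (n + 1)) + 1 := by
        rw [hn1]
        have : e + ((j : Fin (n + 1)) + 1) = e + 0 := by
          rw [add_zero, add_comm (j : Fin (n + 1)) 1, ← add_assoc]
          exact h
        exact add_left_cancel this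
      have := hcast j n (by omega) le_rfl (add_right_cancel h4)
      omega
    · rintro ⟨⟨x, rfl⟩, hne⟩
      obtain ⟨j, hj, rfl⟩ := hcover e x
      refine ⟨j, lt_of_le_of_ne hj ?_, rfl⟩
      rintro rfl
      apply hne
      rw [add_assoc, add_comm (1 : Fin (j + 1)), hn1, add_zero]
      rfl
  have hjoin0 : ∀ e k, k ≤ n → EdgeJoined G (P e n) (some (e + 1))
      (some (e + 1 + (k : Fin (n + 1)))) := by
    intro e k
    induction k with
    | zero =>
      intro _
      simp only [Nat.cast_zero, add_zero]
      exact Relation.ReflTransGen.refl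
    | succ k ih =>
      intro hk
      refine (ih (by omega)).trans (EdgeJoined.of_link (e := Sum.inr (e + 1 + (k : Fin (n + 1))))
        ⟨k, by omega, rfl⟩ ?_)
      rw [hrim]
      push_cast
      rw [← add_assoc]
  have hjoin : ∀ e a b, EdgeJoined G (P e n) (some a) (some b) := by
    intro e a b
    obtain ⟨j, hj, rfl⟩ := hcover e a
    obtain ⟨k, hk, rfl⟩ := hcover e b
    exact (hjoin0 e j hj).symm.trans (hjoin0 e k hk)
  have hindep : ∀ I, (cycleMatroid G).Indep I ↔ IsForest G I := fun I => Iff.rfl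
  have hE : (cycleMatroid G).E = Set.univ := rfl
  have hnot : ¬ IsForest G (rim (n + 1)) := by
    intro h
    refine h.2 (Sum.inr 0) ⟨0, rfl⟩ _ _ ((hrim _ _ _).2 rfl) ?_
    rw [← hPn]
    exact hjoin _ _ _
  have hC : (cycleMatroid G).IsCircuit (rim (n + 1)) := by
    rw [Matroid.isCircuit_iff_dep_forall_sdiff_singleton_indep]
    refine ⟨⟨by rw [hindep]; exact hnot, by rw [hE]; exact Set.subset_univ _⟩, ?_⟩
    rintro _ ⟨e, rfl⟩
    rw [hindep, ← hPn]
    exact hPforest e n le_rfl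
  -- adding a spoke to a forest contained in the cycle gives a forest
  have hspokeInsert : ∀ I, IsForest G I → I ⊆ rim (n + 1) → ∀ i,
      IsForest G (insert (Sum.inl i) I) := by
    intro I hI hIr i
    refine hI.insert (u := some (f i)) (v := none) ?_ ?_
    · rw [hspoke]
      exact Sym2.eq_swap
    · intro hj
      have := hj.eq_of_isolated (by
        rintro a ha z hl
        obtain ⟨x, rfl⟩ := hIr ha
        rw [hrim, Sym2.eq_iff] at hl
        simp at hl)
      simp at this
  refine ⟨hC, ⟨?_, Set.subset_univ _⟩, ?_⟩
  · intro I X hI hX a ha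
    rcases a with i | i
    · exfalso
      have h1 : IsForest G (insert (Sum.inl i) I) :=
        hspokeInsert I hI.indep hI.subset i
      have h2 := hX.mem_of_insert_indep ha h1
      obtain ⟨x, hx⟩ := hI.subset h2
      simp at hx
    · exact ⟨i, rfl⟩
  · have hb : (cycleMatroid G).IsBase (insert (Sum.inl 0) (P 0 n)) := by
      have hfor := hspokeInsert (P 0 n) (hPforest 0 n le_rfl)
        (by rw [hPn]; exact Set.sdiff_subset) 0
      refine Matroid.Indep.isBase_of_maximal (M := cycleMatroid G) hfor fun J hJ hsub => ?_
      refine hsub.antisymm fun a ha => ?_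
      by_contra hna
      have hnone : ∀ x, EdgeJoined G (insert (Sum.inl 0) (P 0 n)) none (some x) := fun x =>
        (EdgeJoined.of_link (Set.mem_insert _ _) ((hspoke 0 _ _).2 rfl)).trans
          ((hjoin 0 (f 0) x).mono (Set.subset_insert _ _))
      have hall : ∀ x y, EdgeJoined G (insert (Sum.inl 0) (P 0 n)) x y := by
        have h0 : ∀ x, EdgeJoined G (insert (Sum.inl 0) (P 0 n)) none x := by
          rintro (_ | x)
          · exact Relation.ReflTransGen.refl
          · exact hnone x
        exact fun x y => (h0 x).symm.trans (h0 y)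
      obtain ⟨x, y, hl⟩ := G.exists_isLink_of_mem_edgeSet (hJ.subset_ground ha)
      have hJa : insert (Sum.inl 0) (P 0 n) ⊆ J \ {a} :=
        fun b hb => ⟨hsub hb, fun h => hna (h ▸ hb)⟩
      exact ((hindep J).1 hJ).2 a ha x y hl ((hall x y).mono hJa)
    rw [hC.eRk_add_one_eq, ← hb.encard_eq_eRank, hPn,
      Set.encard_insert_of_notMem (by simp [rim])]
    exact (Set.encard_sdiff_singleton_add_one (Set.mem_range_self 0)).symm

theorem rim_isCircuitHyperplane_wheelGraph {r : ℕ} (hr : 1 ≤ r) :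
    IsCircuitHyperplane (cycleMatroid (wheelGraph r)) (rim r) := by
  obtain ⟨n, rfl⟩ := Nat.exists_eq_add_of_le' hr
  exact rim_isCircuitHyperplane_aux (fun i => i)

theorem rim_isCircuitHyperplane_graphN {r : ℕ} (hr : 1 ≤ r) :
    IsCircuitHyperplane (cycleMatroid (graphN r)) (rim r) := by
  obtain ⟨n, rfl⟩ := Nat.exists_eq_add_of_le' hr
  exact rim_isCircuitHyperplane_aux (fun i => ⟨0, i.pos⟩)

theorem whirl_isBase_iff {r : ℕ} (hr : 1 ≤ r) (B : Set (Fin r ⊕ Fin r)) :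
    (whirl r).IsBase B ↔ (cycleMatroid (wheelGraph r)).IsBase B ∨ B = rim r := by
  change _ ∨ (_ ∧ _) ↔ _
  simp [rim_isCircuitHyperplane_wheelGraph hr]

theorem relaxedN_isBase_iff {r : ℕ} (hr : 1 ≤ r) (B : Set (Fin r ⊕ Fin r)) :
    (relaxedN r).IsBase B ↔ (cycleMatroid (graphN r)).IsBase B ∨ B = rim r := by
  change _ ∨ (_ ∧ _) ↔ _
  simp [rim_isCircuitHyperplane_graphN hr]

/-! ### Positroids, Grassmann necklaces and envelope classes

An ordered matroid is a matroid on a finite subset of a linearly ordered type. -/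

section Positroid

variable {α : Type*} [LinearOrder α]

/-- A positroid: an ordered matroid realized by a real matrix of full row rank, with columns
indexed in increasing order by the ground set, all of whose maximal minors are nonnegative. -/
def IsPositroid (M : Matroid α) : Prop :=
  M.E.Finite ∧ ∃ (k : ℕ) (A : Matrix (Fin k) M.E ℝ),
    LinearIndependent ℝ A.row ∧
    (∀ I : Set M.E, M.Indep (Subtype.val '' I) ↔ LinearIndepOn ℝ A.col I) ∧
    ∀ c : Fin k ↪o M.E, 0 ≤ (A.submatrix id c).det

/-- The cyclically shifted strict order `<_i`, in which the elements `≥ i` come first, in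
increasing order, followed by the elements `< i`, in increasing order. -/
def CycLT (i x y : α) : Prop :=
  (i ≤ x ∧ x < y) ∨ (x < y ∧ y < i) ∨ (y < i ∧ i ≤ x)

/-- The lexicographic order on finite sets of equal size with respect to `<_i`: `A` precedes
`B` if the first element at which they differ belongs to `A`. -/
def LexLT (i : α) (A B : Set α) : Prop :=
  ∃ x ∈ A \ B, ∀ y, CycLT i y x → (y ∈ A ↔ y ∈ B)

/-- `B` is the lexicographically minimal basis of `M` with respect to `<_i`. -/
def IsLexMinBase (M : Matroid α) (i : α) (B : Set α) : Prop :=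
  M.IsBase B ∧ ∀ B', M.IsBase B' → B' ≠ B → LexLT i B B'

/-- The Grassmann necklace of `M`: its entry at `i` is the lexicographically minimal basis with
respect to `<_i` (which exists and is unique, see `isLexMinBase_iff`). -/
def necklace (M : Matroid α) (i : α) : Set α := {x | ∃ B, IsLexMinBase M i B ∧ x ∈ B}

/-- The envelope class of `P`: the ordered matroids on the ground set of `P` that have the same
Grassmann necklace as `P`. -/
def envelopeClass (P : Matroid α) : Set (Matroid α) :=
  {M | M.E = P.E ∧ ∀ i ∈ P.E, necklace M i = necklace P i}

theorem CycLT.trans {i x y z : α} (h : CycLT i x y) (h' : CycLT i y z) : CycLT i x z := by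
  unfold CycLT at *
  grind

theorem CycLT.irrefl {i x : α} : ¬ CycLT i x x := by
  unfold CycLT
  grind

theorem CycLT.trichotomy {i x y : α} (h : x ≠ y) : CycLT i x y ∨ CycLT i y x := by
  unfold CycLT
  grind

theorem LexLT.irrefl {i : α} {A : Set α} : ¬ LexLT i A A := fun ⟨_, h, _⟩ => h.2 h.1

theorem LexLT.trans {i : α} {A B C : Set α} (h : LexLT i A B) (h' : LexLT i B C) :
    LexLT i A C := by
  obtain ⟨x, hx, hx'⟩ := h
  obtain ⟨y, hy, hy'⟩ := h'
  by_cases hxy : x = y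
  · subst hxy
    exact absurd hy.1 hx.2
  rcases CycLT.trichotomy (i := i) hxy with h | h
  · exact ⟨x, ⟨hx.1, fun hc => hx.2 ((hy' x h).2 hc)⟩,
      fun z hz => (hx' z hz).trans (hy' z (hz.trans h))⟩
  · exact ⟨y, ⟨(hx' y h).2 hy.1, hy.2⟩,
      fun z hz => (hx' z (hz.trans h)).trans (hy' z hz)⟩

theorem LexLT.trichotomy {i : α} {E A B : Set α} (hE : E.Finite) (hA : A ⊆ E) (hB : B ⊆ E)
    (h : A ≠ B) : LexLT i A B ∨ LexLT i B A := by
  have : Finite E := hE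
  let D : Set E := {x | ¬ ((x : α) ∈ A ↔ (x : α) ∈ B)}
  have hD : D.Nonempty := by
    by_contra hcon
    apply h
    ext x
    by_contra hx
    refine hcon ⟨⟨x, ?_⟩, hx⟩
    by_contra hxE
    exact hx ⟨fun h => absurd (hA h) hxE, fun h => absurd (hB h) hxE⟩
  have : IsTrans E (fun x y => CycLT i (x : α) y) := ⟨fun _ _ _ h h' => CycLT.trans h h'⟩
  have : Std.Irrefl (fun x y : E => CycLT i (x : α) y) := ⟨fun _ => CycLT.irrefl⟩
  have hwf : WellFounded (fun x y : E => CycLT i (x : α) y) :=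
    Finite.wellFounded_of_trans_of_irrefl _
  obtain ⟨m, hm, hmin⟩ := hwf.has_min D hD
  have key : ∀ y, CycLT i y m → (y ∈ A ↔ y ∈ B) := by
    intro y hy
    by_contra hn
    by_cases hyE : y ∈ E
    · exact hmin ⟨y, hyE⟩ hn hy
    · exact hn ⟨fun h => absurd (hA h) hyE, fun h => absurd (hB h) hyE⟩
  by_cases hmA : (m : α) ∈ A
  · exact Or.inl ⟨m, ⟨hmA, fun hb => hm ⟨fun _ => hb, fun _ => hmA⟩⟩, key⟩
  · have hmB : (m : α) ∈ B := by
      by_contra hb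
      exact hm ⟨fun h => absurd h hmA, fun h => absurd h hb⟩
    exact Or.inr ⟨m, ⟨hmB, hmA⟩, fun y hy => (key y hy).symm⟩

theorem isLexMinBase_iff {M : Matroid α} (hM : M.E.Finite) (i : α) (B : Set α) :
    IsLexMinBase M i B ↔ B = necklace M i := by
  have huniq : ∀ B B', IsLexMinBase M i B → IsLexMinBase M i B' → B = B' := by
    intro B B' h h'
    by_contra hne
    exact LexLT.irrefl ((h.2 B' h'.1 (Ne.symm hne)).trans (h'.2 B h.1 hne))
  have hex : ∃ B, IsLexMinBase M i B := by
    have : Finite {B // M.IsBase B} :=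
      (hM.finite_subsets.subset (fun B (hB : M.IsBase B) => hB.subset_ground))
    have : IsTrans {B // M.IsBase B} (fun x y => LexLT i (x : Set α) y) :=
      ⟨fun _ _ _ h h' => LexLT.trans h h'⟩
    have : Std.Irrefl (fun x y : {B // M.IsBase B} => LexLT i (x : Set α) y) :=
      ⟨fun _ => LexLT.irrefl⟩
    have hwf : WellFounded (fun x y : {B // M.IsBase B} => LexLT i (x : Set α) y) :=
      Finite.wellFounded_of_trans_of_irrefl _
    obtain ⟨B₀, h₀⟩ := M.exists_isBase
    obtain ⟨m, -, hmin⟩ := hwf.has_min Set.univ ⟨⟨B₀, h₀⟩, trivial⟩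
    refine ⟨m, m.2, fun B' hB' hne => ?_⟩
    rcases LexLT.trichotomy (i := i) hM hB'.subset_ground m.2.subset_ground hne with h | h
    · exact absurd h (hmin ⟨B', hB'⟩ trivial)
    · exact h
  have hval : ∀ B, IsLexMinBase M i B → B = necklace M i := by
    intro B hB
    ext x
    exact ⟨fun hx => ⟨B, hB, hx⟩, fun ⟨B', hB', hx⟩ => huniq B' B hB' hB ▸ hx⟩
  refine ⟨hval B, ?_⟩
  rintro rfl
  obtain ⟨B', hB'⟩ := hex
  exact hval B' hB' ▸ hB'

end Positroid

/-! ### Bases recognised by closure and cardinality. -/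

section General

variable {α : Type*} {M : Matroid α}

/-! Write `s_i` for the spoke `Sum.inl i` and `r_i` for the rim element `Sum.inr i`. The proof
isolates the matroids in which every triangle `{s_i, r_i, s_{i+1}}` is dependent and every spoke
together with all but one rim element is a base (`IsFan`).

Such a matroid is determined by two bits (`IsFan.eq_of_iff`): whether the spokes are parallel and
whether the rim is a base. In the presence of `r_i` the spokes `s_i` and `s_{i+1}` span each other,
so spans propagate around the cycle; one parallel pair of neighbouring spokes makes all spokes
parallel, and in either case the bases other than the rim are forced. The four values of the two
bits are taken by the four matroids of the theorem (`IsFan.exists_eq_fanMatroid`).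

In the cyclic order `s_0, r_0, s_1, r_1, …` the property `IsFan` can be read off the Grassmann
necklace. The necklace is computed greedily (`mem_necklace_iff`), so it records which elements are
spanned by which cyclic intervals preceding them. Here a spoke is spanned exactly from interval
length 2 on and a rim element exactly from length `2r - 2` on (`HasFanPattern`), and this pattern is
equivalent to `IsFan`. Hence the envelope class consists of the `IsFan` matroids with the given
labelling (`map_mem_envelopeClass_iff`).

It remains to see that a positroid isomorphic to the whirl can be labelled in this cyclic order
(`exists_isCyclicLabelling`). For `r = 2` the whirl is uniform and any order will do. For `r ≥ 3`,
nonnegativity of the minors gives a non-crossing property of elements that become parallel in a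
contraction of rank two (`IsPositroid.between_iff`). Contracting suitable sets of spokes shows that
two consecutive elements never separate the others, so they are cyclically adjacent, and the labels
run around the circle in one direction. A reflection of the labels corrects the direction.

For `r ≥ 3` the four matroids are told apart by the presence of parallel spokes and by the number of
bases. -/

theorem isBase_of_base_subset_closure {B X : Set α} (hB : M.IsBase B) (hBf : B.Finite)
    (hX : X ⊆ M.E) (h : B ⊆ M.closure X) (hc : X.encard ≤ B.encard) : M.IsBase X := by
  have hsp : M.Spanning X := by
    rw [Matroid.spanning_iff_ground_subset_closure, ← hB.closure_eq]
    exact M.closure_subset_closure_of_subset_closure h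
  obtain ⟨B', hB', hsub⟩ := hsp.exists_isBase_subset
  have he := hB'.encard_eq_encard_of_isBase hB
  have hfin : X.Finite := Set.finite_of_encard_le_coe (k := B.ncard) (by
    rwa [hBf.cast_ncard_eq])
  have hX := (hfin.subset hsub).eq_of_subset_of_encard_le hsub (hc.trans_eq he.symm)
  exact hX ▸ hB'

end General

/-! ### The Grassmann necklace as a greedy basis. -/

section Necklace

variable {α : Type*} [LinearOrder α]

/-- The Grassmann necklace is computed greedily. -/
theorem mem_necklace_iff {M : Matroid α} (hM : M.E.Finite) (i x : α) :
    x ∈ necklace M i ↔ x ∈ M.E ∧ x ∉ M.closure {y ∈ M.E | CycLT i y x} := by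
  have hB := (isLexMinBase_iff hM i _).2 rfl
  set B := necklace M i with hBdef
  obtain ⟨hB, hmin⟩ := hB
  constructor
  · intro hx
    refine ⟨hB.subset_ground hx, fun hcl => ?_⟩
    have hnot := hB.indep.notMem_closure_sdiff_of_mem hx
    -- The earlier elements span `x` but `B \ {x}` does not, so some earlier `y` is outside the
    -- latter's closure; exchanging `x` for `y` contradicts minimality.
    obtain ⟨y, ⟨hyE, hy⟩, hyn⟩ : ∃ y ∈ {y ∈ M.E | CycLT i y x}, y ∉ M.closure (B \ {x}) := by
      by_contra! hcon
      exact hnot (M.closure_subset_closure_of_subset_closure hcon hcl)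
    have hyx : y ≠ x := by rintro rfl; exact CycLT.irrefl hy
    have hyB : y ∉ B := fun h => hyn (M.mem_closure_of_mem' ⟨h, hyx⟩ hyE)
    have hB' : M.IsBase (insert y (B \ {x})) :=
      hB.exchange_base_of_notMem_closure hx hyn
    obtain ⟨z, hz, hz'⟩ := hmin _ hB' (fun h => hyB (h ▸ Set.mem_insert _ _))
    have hzx : z = x := by
      by_contra h
      exact hz.2 (Or.inr ⟨hz.1, h⟩)
    subst hzx
    exact hyB ((hz' y hy).2 (Set.mem_insert _ _))
  · rintro ⟨hxE, hcl⟩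
    by_contra hx
    -- Elements earlier than `x` do not span it, so the fundamental circuit of `x` in `B` contains a
    -- later `z`; exchanging `z` for `x` contradicts minimality.
    obtain ⟨z, hzB, hzI, hxz⟩ : ∃ z ∈ B, ¬ CycLT i z x ∧ x ∉ M.closure (B \ {z}) := by
      by_contra! hcon
      apply hcl
      have hxB : x ∈ M.closure B := by rw [hB.closure_eq]; exact hxE
      have hC := hB.indep.fundCircuit_isCircuit hxB hx
      have hsub : M.fundCircuit x B \ {x} ⊆ {y ∈ M.E | CycLT i y x} := by
        rintro z ⟨hz, hzx⟩
        refine ⟨hC.subset_ground hz, ?_⟩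
        have hzB : z ∈ B := by
          rcases M.fundCircuit_subset_insert x B hz with h | h
          · exact absurd h hzx
          · exact h
        by_contra hlt
        have := hcon z hzB hlt
        rw [(hB.indep.mem_fundCircuit_iff hxB hx)] at hz
        have hxz : x ∉ B \ {z} := fun h => hx h.1
        rw [(hB.indep.subset Set.sdiff_subset).mem_closure_iff_of_notMem hxz] at this
        refine this.not_indep (hz.subset ?_)
        rintro a (rfl | ha)
        · exact ⟨Or.inl rfl, fun h => hx (h ▸ hzB)⟩
        · exact ⟨Or.inr ha.1, ha.2⟩
      exact M.closure_subset_closure hsub (hC.mem_closure_sdiff_singleton_of_mem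
        (M.mem_fundCircuit x B))
    have hB' : M.IsBase (insert x (B \ {z})) := hB.exchange_base_of_notMem_closure hzB hxz
    obtain ⟨w, hw, hw'⟩ := hmin _ hB' (fun h => hx (h ▸ Set.mem_insert _ _))
    have hwz : w = z := by
      by_contra h
      exact hw.2 (Or.inr ⟨hw.1, h⟩)
    subst hwz
    have hwx : w ≠ x := fun h => hx (h ▸ hzB)
    rcases CycLT.trichotomy (i := i) hwx with h | h
    · exact hzI h
    · exact hx ((hw' x h).2 (Set.mem_insert _ _))

end Necklace

/-! ### Sign constraints from nonnegative maximal minors. -/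

section Positive

open Matrix

theorem det_vandermonde_pos {k : ℕ} {x : Fin k → ℝ} (hx : StrictMono x) :
    0 < (vandermonde x).det := by
  rw [det_vandermonde]
  exact Finset.prod_pos fun i _ => Finset.prod_pos fun j hj =>
    sub_pos.2 (hx (Finset.mem_Ioi.1 hj))

/-- Both determinants change by the sign of the permutation when `c` is sorted, and the Vandermonde
determinant of increasing nodes is positive. It thus stands in for the sign of the sorting
permutation, which never has to be computed. -/
theorem det_mul_det_vandermonde_nonneg {k : ℕ} {E : Type*} [LinearOrder E]
    {A : Matrix (Fin k) E ℝ} (hA : ∀ c : Fin k ↪o E, 0 ≤ (A.submatrix id c).det)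
    {x : E → ℝ} (hx : StrictMono x) (c : Fin k → E) :
    0 ≤ (A.submatrix id c).det * (vandermonde (x ∘ c)).det := by
  by_cases hc : Function.Injective c
  · set σ := Tuple.sort c
    have hmono : StrictMono (c ∘ σ) :=
      (Tuple.monotone_sort c).strictMono_of_injective (hc.comp σ.injective)
    have h1 := hA (OrderEmbedding.ofStrictMono _ hmono)
    have h2 := det_vandermonde_pos (hx.comp hmono)
    have e1 : (A.submatrix id (OrderEmbedding.ofStrictMono _ hmono)).det =
        (Equiv.Perm.sign σ : ℝ) * (A.submatrix id c).det := by
      rw [← det_permute']; rfl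
    have e2 : (vandermonde (x ∘ (c ∘ σ))).det =
        (Equiv.Perm.sign σ : ℝ) * (vandermonde (x ∘ c)).det := by
      rw [← det_permute]; rfl
    have h3 := mul_nonneg h1 h2.le
    have hs : ((Equiv.Perm.sign σ : ℤ) : ℝ) * ((Equiv.Perm.sign σ : ℤ) : ℝ) = 1 := by
      exact_mod_cast Int.units_coe_mul_self _
    rw [e1, e2] at h3
    nlinarith [h3, hs]
  · have : (vandermonde (x ∘ c)).det = 0 := by
      rw [det_vandermonde_eq_zero_iff]
      simp only [Function.Injective, not_forall] at hc
      obtain ⟨a, b, h, hne⟩ := hc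
      exact ⟨a, b, congrArg x h, hne⟩
    simp [this]

/-- Isolates `b - p`, the only factor in which the first two nodes interact. -/
theorem det_vandermonde_cons_cons {m : ℕ} (p b : ℝ) (q : Fin m → ℝ) :
    (vandermonde (Fin.cons p (Fin.cons b q : Fin (m + 1) → ℝ) : Fin (m + 2) → ℝ)).det =
      (b - p) * (∏ j, (q j - p)) * (∏ j, (q j - b)) * (vandermonde q).det := by
  simp only [det_vandermonde]
  rw [Fin.prod_univ_succ, Fin.prod_univ_succ]
  simp only [Fin.prod_Ioi_zero, Fin.prod_Ioi_succ, Fin.cons_zero, Fin.cons_succ]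
  rw [Fin.prod_univ_succ]
  simp only [Fin.cons_zero, Fin.cons_succ]
  ring

theorem linearIndependent_col_comp_iff_det_ne_zero {k : ℕ} {E : Type*}
    (A : Matrix (Fin k) E ℝ) (c : Fin k → E) :
    LinearIndependent ℝ (A.col ∘ c) ↔ (A.submatrix id c).det ≠ 0 := by
  rw [← isUnit_iff_ne_zero, ← Matrix.isUnit_iff_isUnit_det,
    ← Matrix.linearIndependent_cols_iff_isUnit]
  rfl

/-- The determinant is linear in its first column, and the part of that column in the span of the
columns of `c` contributes zero. What matters is that the scalar `t` does not depend on `y`. -/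
theorem det_submatrix_cons_of_mem_span {m : ℕ} {E : Type*} {A : Matrix (Fin (m + 2)) E ℝ}
    {p q : E} {c : Fin m → E}
    (hpq : A.col p ∈ Submodule.span ℝ (insert (A.col q) (Set.range (A.col ∘ c)))) :
    ∃ t : ℝ, ∀ y, (A.submatrix id (Fin.cons p (Fin.cons y c : Fin (m + 1) → E) :
        Fin (m + 2) → E)).det =
      t * (A.submatrix id (Fin.cons q (Fin.cons y c : Fin (m + 1) → E) :
        Fin (m + 2) → E)).det := by
  obtain ⟨t, z, hz, ht⟩ := Submodule.mem_span_insert.1 hpq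
  refine ⟨t, fun y => ?_⟩
  set f : (Fin (m + 2) → ℝ) [⋀^Fin (m + 2)]→ₗ[ℝ] ℝ := Matrix.detRowAlternating
  let w : Fin (m + 1) → (Fin (m + 2) → ℝ) := Fin.cons (A.col y) (A.col ∘ c)
  let L : (Fin (m + 2) → ℝ) →ₗ[ℝ] ℝ :=
    { toFun := fun v => f.curryLeft v w
      map_add' := fun a b => by simp
      map_smul' := fun a b => by simp }
  have hL : ∀ x, (A.submatrix id (Fin.cons x (Fin.cons y c : Fin (m + 1) → E) :
      Fin (m + 2) → E)).det = L (A.col x) := by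
    intro x
    rw [← Matrix.det_transpose]
    change f _ = f _
    congr 1
    ext i j
    refine Fin.cases ?_ (fun i => Fin.cases ?_ (fun i => ?_) i) i <;> rfl
  have hz0 : L z = 0 := by
    have : Submodule.span ℝ (Set.range (A.col ∘ c)) ≤ LinearMap.ker L := by
      rw [Submodule.span_le]
      rintro _ ⟨i, rfl⟩
      change f _ = 0
      exact f.map_eq_zero_of_eq (i := 0) (j := i.succ.succ) _ rfl (Fin.succ_ne_zero _).symm
    exact this hz
  rw [hL, hL, ht, map_add, hz0, map_smul, add_zero, smul_eq_mul]

/-- In the quotient by the columns of `c` the columns `p` and `q` are proportional, by a factor `t`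
that is the same for `b` and `d`. Comparing signs of minors with Vandermonde signs shows that `b`
and `d` lie on the same side of the pair `p, q`. -/
theorem noncrossing_of_det_nonneg {m : ℕ} {E : Type*} [LinearOrder E]
    {A : Matrix (Fin (m + 2)) E ℝ} (hA : ∀ c : Fin (m + 2) ↪o E, 0 ≤ (A.submatrix id c).det)
    {x : E → ℝ} (hx : StrictMono x) {p q b d : E} {c : Fin m → E}
    (hpq : A.col p ∈ Submodule.span ℝ (insert (A.col q) (Set.range (A.col ∘ c))))
    (hind : ∀ z, z = p ∨ z = q → ∀ y, y = b ∨ y = d → LinearIndependent ℝ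
      (A.col ∘ (Fin.cons z (Fin.cons y c : Fin (m + 1) → E) : Fin (m + 2) → E))) :
    0 < (x b - x p) * (x b - x q) * ((x d - x p) * (x d - x q)) := by
  set D : E → E → ℝ := fun z y => (A.submatrix id
    (Fin.cons z (Fin.cons y c : Fin (m + 1) → E) : Fin (m + 2) → E)).det with hD
  set h : E → ℝ := fun z => ∏ j, (x (c j) - x z)
  set V : ℝ := (vandermonde (x ∘ c)).det
  obtain ⟨t, ht⟩ := det_submatrix_cons_of_mem_span hpq
  replace ht : ∀ y, D p y = t * D q y := ht
  have key : ∀ z, z = p ∨ z = q → ∀ y, y = b ∨ y = d →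
      0 < D z y * ((x y - x z) * h z * h y * V) := by
    intro z hz y hy
    have hli := hind z hz y hy
    have h1 := det_mul_det_vandermonde_nonneg hA hx
      (Fin.cons z (Fin.cons y c : Fin (m + 1) → E) : Fin (m + 2) → E)
    have hinj : Function.Injective
        (Fin.cons z (Fin.cons y c : Fin (m + 1) → E) : Fin (m + 2) → E) :=
      Function.Injective.of_comp hli.injective
    have hne := det_vandermonde_ne_zero_iff.2 (hx.injective.comp hinj)
    have h2 := lt_of_le_of_ne h1 (mul_ne_zero
      ((linearIndependent_col_comp_iff_det_ne_zero _ _).1 hli) hne).symm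
    have e : x ∘ (Fin.cons z (Fin.cons y c : Fin (m + 1) → E) : Fin (m + 2) → E) =
        (Fin.cons (x z) (Fin.cons (x y) (x ∘ c) : Fin (m + 1) → ℝ) : Fin (m + 2) → ℝ) := by
      ext i
      refine Fin.cases ?_ (fun i => Fin.cases ?_ (fun i => ?_) i) i <;> rfl
    rw [e, det_vandermonde_cons_cons] at h2
    exact h2
  -- In the product of the inequalities for `p` and `q` every factor depending on `y` occurs
  -- squared, apart from `(x y - x p) * (x y - x q)`. The sign of the latter is therefore that of `t
  -- * h p * h q`.
  have side : ∀ y, y = b ∨ y = d → 0 < t * h p * h q * ((x y - x p) * (x y - x q)) := by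
    intro y hy
    have h1 := mul_pos (key p (Or.inl rfl) y hy) (key q (Or.inr rfl) y hy)
    rw [ht] at h1
    have : t * D q y * ((x y - x p) * h p * h y * V) * (D q y * ((x y - x q) * h q * h y * V)) =
      (t * h p * h q * ((x y - x p) * (x y - x q))) * (D q y * h y * V) ^ 2 := by ring
    rw [this] at h1
    exact pos_of_mul_pos_left h1 (sq_nonneg _)
  have h1 := mul_pos (side b (Or.inl rfl)) (side d (Or.inr rfl))
  have : t * h p * h q * ((x b - x p) * (x b - x q)) *
      (t * h p * h q * ((x d - x p) * (x d - x q))) =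
    (x b - x p) * (x b - x q) * ((x d - x p) * (x d - x q)) * (t * h p * h q) ^ 2 := by ring
  rw [this] at h1
  exact pos_of_mul_pos_left h1 (sq_nonneg _)

end Positive
-- The non-crossing property of positroids.
section Positroid

variable {α : Type*} [LinearOrder α]

/-- The element `x` lies strictly between `a` and `b`. -/
def Between (a b x : α) : Prop := (a < x ∧ x < b) ∨ (b < x ∧ x < a)

theorem Between.symm_iff {a b x : α} : Between a b x ↔ Between b a x := or_comm

theorem between_iff_of_pos {E : Type*} [LinearOrder E] {x : E → ℝ} (hx : StrictMono x)
    {p q b d : E} (h : 0 < (x b - x p) * (x b - x q) * ((x d - x p) * (x d - x q))) :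
    Between p q b ↔ Between p q d := by
  have key : ∀ y, Between p q y ↔ (x y - x p) * (x y - x q) < 0 := by
    intro y
    rw [mul_neg_iff, sub_pos, sub_neg, sub_pos, sub_neg, hx.lt_iff_lt, hx.lt_iff_lt,
      hx.lt_iff_lt, hx.lt_iff_lt]
    unfold Between
    tauto
  rw [key, key]
  constructor
  · intro hb
    rcases mul_pos_iff.1 h with h | h
    · exact absurd hb h.1.le.not_gt
    · exact h.2
  · intro hb
    rcases mul_pos_iff.1 h with h | h
    · exact absurd hb h.2.le.not_gt
    · exact h.1

theorem exists_strictMono_real (E : Type*) [LinearOrder E] [Finite E] :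
    ∃ x : E → ℝ, StrictMono x := by
  refine ⟨fun e => ((Set.Iio e).ncard : ℝ), fun a b hab => ?_⟩
  simp only [Nat.cast_lt]
  refine Set.ncard_lt_ncard ⟨Set.Iio_subset_Iio hab.le, fun h => ?_⟩ (Set.toFinite _)
  exact lt_irrefl a (h hab)

/-- `IsPositroid` leaves the number of rows free; full row rank, by equality of row and column rank,
ties it to the size of the bases. -/
theorem ncard_eq_of_linearIndependent_row {k : ℕ} {E : Type*} [Finite E]
    {A : Matrix (Fin k) E ℝ} (hrow : LinearIndependent ℝ A.row) {B : Set E}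
    (hB : LinearIndepOn ℝ A.col B)
    (hmax : ∀ e ∉ B, ¬ LinearIndepOn ℝ A.col (insert e B)) : B.ncard = k := by
  have := Fintype.ofFinite E
  classical
  have hspan : Submodule.span ℝ (A.col '' B) = Submodule.span ℝ (Set.range A.col) := by
    refine le_antisymm (Submodule.span_mono (Set.image_subset_range _ _)) ?_
    rw [Submodule.span_le]
    rintro _ ⟨e, rfl⟩
    by_cases he : e ∈ B
    · exact Submodule.subset_span ⟨e, he, rfl⟩
    · by_contra hn
      exact hmax e he (hB.insert hn)
  have h1 : Module.finrank ℝ (Submodule.span ℝ (A.col '' B)) = k := by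
    rw [hspan, ← Matrix.rank_eq_finrank_span_cols, hrow.rank_matrix, Fintype.card_fin]
  have h2 := finrank_span_set_eq_card (R := ℝ) (s := A.col '' B) hB.id_image
  rw [← h1, h2, ← Set.ncard_eq_toFinset_card', hB.injOn.ncard_image]

/-- In the contraction of `P` by `Q`, of rank two, `p` and `q` are parallel while `b` and `d` are in
other parallel classes. The parallel class of `p` and `q` may not separate `b` from `d` in one
direction only, by `noncrossing_of_det_nonneg`. -/
theorem IsPositroid.between_iff {P : Matroid α} (hP : IsPositroid P) {Q : Set α} {p q b d : α}
    (hp : p ∉ Q) (hq : q ∉ Q) (hb : b ∉ Q) (hd : d ∉ Q)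
    (hpb : p ≠ b) (hpd : p ≠ d) (hqb : q ≠ b) (hqd : q ≠ d)
    (hbase : ∀ z, z = p ∨ z = q → ∀ y, y = b ∨ y = d → P.IsBase (insert z (insert y Q)))
    (hpq : ¬ P.Indep (insert p (insert q Q))) : Between p q b ↔ Between p q d := by
  obtain ⟨hfin, k, A, hrow, hA, hpos⟩ := hP
  have : Finite P.E := hfin
  have hpE : p ∈ P.E := (hbase p (.inl rfl) b (.inl rfl)).subset_ground (by simp)
  have hqE : q ∈ P.E := (hbase q (.inr rfl) b (.inl rfl)).subset_ground (by simp)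
  have hbE : b ∈ P.E := (hbase p (.inl rfl) b (.inl rfl)).subset_ground (by simp)
  have hdE : d ∈ P.E := (hbase p (.inl rfl) d (.inr rfl)).subset_ground (by simp)
  have hQE : Q ⊆ P.E := fun x hx =>
    (hbase p (.inl rfl) b (.inl rfl)).subset_ground (by simp [hx])
  lift p to P.E using hpE
  lift q to P.E using hqE
  lift b to P.E using hbE
  lift d to P.E using hdE
  lift Q to Set P.E using hQE
  simp only [Set.mem_image, Subtype.coe_inj, exists_eq_right, ne_eq] at hp hq hb hd hpb hpd hqb hqd
  replace hbase : ∀ z, z = p ∨ z = q → ∀ y, y = b ∨ y = d →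
      P.IsBase (Subtype.val '' (insert z (insert y Q))) := by
    intro z hz y hy
    rw [Set.image_insert_eq, Set.image_insert_eq]
    exact hbase z (by simpa [Subtype.coe_inj] using hz) y (by simpa [Subtype.coe_inj] using hy)
  rw [← Set.image_insert_eq, ← Set.image_insert_eq, hA] at hpq
  have hk : (insert p (insert b Q)).ncard = k := by
    have hB := hbase p (.inl rfl) b (.inl rfl)
    refine ncard_eq_of_linearIndependent_row hrow ((hA _).1 hB.indep) fun e he hn => ?_
    have h := hB.eq_of_subset_indep ((hA _).2 hn) (Set.image_mono (Set.subset_insert _ _))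
    exact he ((Set.image_injective.2 Subtype.val_injective h) ▸ Set.mem_insert _ _)
  rw [Set.ncard_insert_of_notMem (by simp [hp, hpb]), Set.ncard_insert_of_notMem hb] at hk
  obtain ⟨m, c, hc, rfl⟩ : ∃ m, ∃ c : Fin m → P.E, Function.Injective c ∧ Set.range c = Q :=
    ⟨Nat.card Q, Subtype.val ∘ (Finite.equivFin Q).symm,
      Subtype.val_injective.comp (Equiv.injective _), by
        rw [Set.range_comp, Equiv.range_eq_univ, Set.image_univ, Subtype.range_coe]⟩
  rw [← Set.image_univ, hc.injOn.ncard_image, Set.ncard_univ, Nat.card_fin] at hk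
  subst hk
  obtain ⟨x, hx⟩ := exists_strictMono_real P.E
  have := noncrossing_of_det_nonneg (p := p) (q := q) (b := b) (d := d) (c := c) hpos hx ?_ ?_
  · exact between_iff_of_pos hx this
  · have hq' : LinearIndepOn ℝ A.col (insert q (Set.range c)) :=
      ((hA _).1 (hbase q (.inr rfl) b (.inl rfl)).indep).mono
        (Set.insert_subset_insert (Set.subset_insert _ _))
    by_contra hn
    apply hpq
    refine hq'.insert ?_
    rwa [Set.image_insert_eq, ← Set.range_comp]
  · intro z hz y hy
    have hli := (hA _).1 (hbase z hz y hy).indep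
    have hyQ : y ∉ Set.range c := by rcases hy with rfl | rfl <;> assumption
    have hzQ : z ∉ Set.range c := by rcases hz with rfl | rfl <;> assumption
    have hzy : z ≠ y := by rcases hy with rfl | rfl <;> rcases hz with rfl | rfl <;> assumption
    have hinj : Function.Injective
        (Fin.cons z (Fin.cons y c : Fin _ → P.E) : Fin _ → P.E) := by
      rw [Fin.cons_injective_iff, Fin.cons_injective_iff, Fin.range_cons]
      exact ⟨by rintro (h | h); exacts [hzy h, hzQ h], hyQ, hc⟩
    refine hli.linearIndependent.comp (fun i => ⟨(Fin.cons z (Fin.cons y c : Fin _ → P.E) :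
      Fin _ → P.E) i, ?_⟩) ?_
    · have : (Fin.cons z (Fin.cons y c : Fin _ → P.E) : Fin _ → P.E) i ∈ Set.range
        (Fin.cons z (Fin.cons y c : Fin _ → P.E) : Fin _ → P.E) := ⟨i, rfl⟩
      rwa [Fin.range_cons, Fin.range_cons] at this
    · intro i j h
      exact hinj (congrArg Subtype.val h)

end Positroid

/-! ### Walking around a cycle of length `r`. -/

section Cyclic

variable {r : ℕ}

theorem finRotate_ne_self (hr : 2 ≤ r) (i : Fin r) : finRotate r i ≠ i := by
  obtain ⟨n, rfl⟩ := Nat.exists_eq_add_of_le' hr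
  intro h
  have : i ∈ (finRotate (n + 2)).support := by simp
  exact (Equiv.Perm.mem_support.1 this) h

theorem finRotate_ofNat [NeZero r] (k : ℕ) :
    finRotate r (Fin.ofNat r k) = Fin.ofNat r (k + 1) := by
  rw [finRotate_apply]
  ext
  simp [Fin.val_add]

theorem exists_ofNat_add [NeZero r] (a : ℕ) (i : Fin r) :
    ∃ m < r, i = Fin.ofNat r (a + m) := by
  have hr : 0 < r := Nat.pos_of_ne_zero (NeZero.ne r)
  -- This is the residue of `i - a`, with `r - a % r` in place of `-a` to avoid truncated
  -- subtraction.
  refine ⟨(i + (r - a % r)) % r, Nat.mod_lt _ hr, ?_⟩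
  ext
  have h1 : a % r < r := Nat.mod_lt _ hr
  have h2 : (a + (i + (r - a % r)) % r) % r = (i : ℕ) % r := by
    rw [Nat.add_mod_mod]
    have h3 : a + (i + (r - a % r)) = i + r * (a / r + 1) := by
      have := Nat.div_add_mod a r
      have h4 : r * (a / r + 1) = r * (a / r) + r := by ring
      omega
    rw [h3, Nat.add_mul_mod_self_left]
  rw [Fin.val_ofNat, h2, Nat.mod_eq_of_lt i.2]

theorem ofNat_eq_ofNat_iff [NeZero r] {a b : ℕ} :
    Fin.ofNat r a = Fin.ofNat r b ↔ a % r = b % r := by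
  rw [Fin.ext_iff, Fin.val_ofNat, Fin.val_ofNat]

theorem ofNat_add_left_inj [NeZero r] {a m m' : ℕ} (hm : m < r) (hm' : m' < r) :
    Fin.ofNat r (a + m) = Fin.ofNat r (a + m') ↔ m = m' := by
  rw [ofNat_eq_ofNat_iff]
  refine ⟨fun h => ?_, fun h => h ▸ rfl⟩
  have := Nat.ModEq.add_left_cancel' a (show a + m ≡ a + m' [MOD r] from h)
  rwa [Nat.ModEq, Nat.mod_eq_of_lt hm, Nat.mod_eq_of_lt hm'] at this

/-- A nonempty set of vertices of a cycle that is not separated from its complement by more than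
one edge is everything. -/
theorem eq_univ_of_finRotate {T : Set (Fin r)} (hT : T.Nonempty) (j : Fin r)
    (h : ∀ k, k ≠ j → (k ∈ T ↔ finRotate r k ∈ T)) : T = Set.univ := by
  have : NeZero r := ⟨by rintro rfl; exact j.elim0⟩
  -- The walk from `j + 1` around to `j` never uses the exceptional edge `j`.
  have hj : ∀ m < r, (Fin.ofNat r (j + 1 + m) ∈ T ↔ Fin.ofNat r (j + 1) ∈ T) := by
    intro m
    induction m with
    | zero => intro _; rfl
    | succ m ih =>
      intro hm
      rw [← ih (by omega), ← Nat.add_assoc, ← finRotate_ofNat]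
      refine (h _ fun hc => ?_).symm
      have hjj : j = Fin.ofNat r (j + 0) := by
        ext; simp
      rw [hjj, add_assoc] at hc
      have : Fin.ofNat r (j + (1 + m)) = Fin.ofNat r (j + 0) := by
        simpa [Nat.mod_eq_of_lt j.2] using hc
      rw [ofNat_add_left_inj (by omega) (by omega)] at this
      omega
  obtain ⟨i, hi⟩ := hT
  obtain ⟨m, hm, rfl⟩ := exists_ofNat_add (j + 1) i
  ext k
  obtain ⟨m', hm', rfl⟩ := exists_ofNat_add (j + 1) k
  simp only [Set.mem_univ, iff_true]
  rw [hj _ hm']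
  exact (hj _ hm).1 hi

theorem eq_univ_of_finRotate_closed {T : Set (Fin r)} (hT : T.Nonempty)
    (h : ∀ k ∈ T, finRotate r k ∈ T) : T = Set.univ := by
  obtain ⟨i, hi⟩ := hT
  have : NeZero r := ⟨by rintro rfl; exact i.elim0⟩
  ext k
  obtain ⟨m, -, rfl⟩ := exists_ofNat_add i k
  simp only [Set.mem_univ, iff_true]
  induction m with
  | zero => simpa using hi
  | succ m ih =>
    rw [← add_assoc, ← finRotate_ofNat]
    exact h _ ih

end Cyclic

/-! ### Fan matroids are determined by two bits. -/

section Fan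

open Set

variable {r : ℕ}

theorem encard_rim : (rim r).encard = r := by
  rw [rim, ← image_univ, Sum.inr_injective.encard_image, encard_univ]
  simp

theorem encard_insert_rim_sdiff (i j : Fin r) :
    (insert (Sum.inl i : Fin r ⊕ Fin r) (rim r \ {Sum.inr j})).encard = r := by
  rw [encard_insert_of_notMem (by simp [rim]), encard_sdiff_singleton_add_one
    (show Sum.inr j ∈ rim r from ⟨j, rfl⟩),
    encard_rim]

/-- The common properties of the cycle matroids of the wheel and of `N_r` and of their
relaxations. -/
structure IsFan (M : Matroid (Fin r ⊕ Fin r)) : Prop where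
  ground : M.E = univ
  not_indep_tri : ∀ i, ¬ M.Indep {Sum.inl i, Sum.inr i, Sum.inl (finRotate r i)}
  isBase : ∀ i j, M.IsBase (insert (Sum.inl i) (rim r \ {Sum.inr j}))

variable {M M' : Matroid (Fin r ⊕ Fin r)}

theorem exists_ne_of_two_le (hr : 2 ≤ r) (i : Fin r) : ∃ j, j ≠ i :=
  ⟨_, finRotate_ne_self hr i⟩

theorem mem_closure_of_insert_not_indep {α : Type*} {M : Matroid α} {X : Set α} {e : α}
    (hX : M.Indep X) (he : e ∈ M.E) (h : ¬ M.Indep (insert e X)) : e ∈ M.closure X := by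
  by_contra hn
  exact h ((hX.notMem_closure_iff (he := he)).1 hn).1

theorem IsFan.indep_spoke_rim (h : IsFan M) (hr : 2 ≤ r) (i j : Fin r) :
    M.Indep {Sum.inl i, Sum.inr j} := by
  obtain ⟨k, hk⟩ := exists_ne_of_two_le hr j
  refine (h.isBase i k).indep.subset ?_
  rintro x (rfl | rfl)
  · exact mem_insert _ _
  · exact .inr ⟨⟨j, rfl⟩, by simpa using hk.symm⟩

theorem IsFan.encard_eq (h : IsFan M) {B : Set (Fin r ⊕ Fin r)} (hr : 2 ≤ r)
    (hB : M.IsBase B) : B.encard = r := by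
  have i : Fin r := ⟨0, by omega⟩
  rw [hB.encard_eq_encard_of_isBase (h.isBase i i), encard_insert_rim_sdiff]

theorem IsFan.next (h : IsFan M) (hr : 2 ≤ r) (i : Fin r) :
    Sum.inl (finRotate r i) ∈ M.closure {Sum.inl i, Sum.inr i} := by
  refine mem_closure_of_insert_not_indep (h.indep_spoke_rim hr _ _) (by simp [h.ground]) ?_
  convert h.not_indep_tri i using 2
  ext; simp; tauto

theorem IsFan.prev (h : IsFan M) (hr : 2 ≤ r) (i : Fin r) :
    Sum.inl i ∈ M.closure {Sum.inl (finRotate r i), Sum.inr i} := by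
  refine mem_closure_of_insert_not_indep (h.indep_spoke_rim hr _ _) (by simp [h.ground]) ?_
  convert h.not_indep_tri i using 2
  ext; simp; tauto

/-- The triangle makes its two spokes interchangeable once the rim element is spanned. Iterated,
this transports spokes around the cycle inside a closure. -/
theorem IsFan.spoke_mem_closure_iff (h : IsFan M) (hr : 2 ≤ r) {X : Set (Fin r ⊕ Fin r)}
    {i : Fin r} (hi : Sum.inr i ∈ M.closure X) :
    Sum.inl i ∈ M.closure X ↔ Sum.inl (finRotate r i) ∈ M.closure X := by
  constructor <;> intro hs
  · exact M.closure_subset_closure_of_subset_closure (pair_subset hs hi) (h.next hr i)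
  · exact M.closure_subset_closure_of_subset_closure (pair_subset hs hi) (h.prev hr i)

theorem IsFan.rim_mem_closure (h : IsFan M) {i : Fin r}
    (hi : M.Indep {Sum.inl i, Sum.inl (finRotate r i)}) :
    Sum.inr i ∈ M.closure {Sum.inl i, Sum.inl (finRotate r i)} := by
  refine mem_closure_of_insert_not_indep hi (by simp [h.ground]) ?_
  convert h.not_indep_tri i using 2
  ext; simp; tauto

theorem IsFan.indep_singleton (h : IsFan M) (i : Fin r) : M.Indep {Sum.inl i} :=
  (h.isBase i i).indep.subset (singleton_subset_iff.2 (mem_insert _ _))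

/-- If the spokes at `i`, `i + 1` were parallel but those at `i + 1`, `i + 2` independent, a set of
`r - 1` elements would span. -/
theorem IsFan.not_indep_rotate (h : IsFan M) (hr : 2 ≤ r) {i : Fin r}
    (hi : ¬ M.Indep {Sum.inl i, Sum.inl (finRotate r i)}) :
    ¬ M.Indep {Sum.inl (finRotate r i), Sum.inl (finRotate r (finRotate r i))} := by
  intro hn
  set j := finRotate r i with hj
  have hij : i ≠ j := (finRotate_ne_self hr i).symm
  -- This set has `r - 1` elements. The rim elements at `i` and `j = i + 1` are left out: the first
  -- is bridged by parallelism, the second is recovered from the two independent spokes of its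
  -- triangle.
  set X : Set (Fin r ⊕ Fin r) :=
    insert (Sum.inl (finRotate r j)) ((rim r \ {Sum.inr i}) \ {Sum.inr j}) with hX
  have hXE : X ⊆ M.E := by simp [h.ground]
  have hXcl : X ⊆ M.closure X := M.subset_closure X
  have hi1 : Sum.inl j ∈ M.closure {Sum.inl i} :=
    mem_closure_of_insert_not_indep (h.indep_singleton i) (by simp [h.ground])
      (by rwa [pair_comm])
  have hi2 : Sum.inl i ∈ M.closure {Sum.inl j} :=
    mem_closure_of_insert_not_indep (h.indep_singleton j) (by simp [h.ground]) hi
  have hT : {k | Sum.inl k ∈ M.closure X} = univ := by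
    refine eq_univ_of_finRotate ⟨finRotate r j, hXcl (mem_insert _ _)⟩ j fun k hk => ?_
    by_cases hki : k = i
    · subst hki
      exact ⟨fun hs => M.closure_subset_closure_of_subset_closure (singleton_subset_iff.2 hs) hi1,
        fun hs => M.closure_subset_closure_of_subset_closure (singleton_subset_iff.2 hs) hi2⟩
    · exact h.spoke_mem_closure_iff hr
        (hXcl (.inr ⟨⟨⟨k, rfl⟩, by simpa using hki⟩, by simpa using hk⟩))
  have hall : ∀ k, Sum.inl k ∈ M.closure X := fun k => by
    have : k ∈ {k | Sum.inl k ∈ M.closure X} := hT ▸ mem_univ k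
    exact this
  have hjX : Sum.inr j ∈ M.closure X :=
    M.closure_subset_closure_of_subset_closure (pair_subset (hall _) (hall _))
      (h.rim_mem_closure hn)
  have hb := h.isBase i i
  have hsub : insert (Sum.inl i) (rim r \ {Sum.inr i}) ⊆ M.closure X := by
    refine insert_subset (hall _) fun x hx => ?_
    by_cases hxj : x = Sum.inr j
    · exact hxj ▸ hjX
    · exact hXcl (.inr ⟨hx, hxj⟩)
  have h1 := hb.indep.encard_le_eRk_of_subset hsub
  rw [M.eRk_closure_eq, encard_insert_rim_sdiff] at h1
  have h2 := h1.trans (M.eRk_le_encard X)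
  have h3 : X.encard + 1 = r := by
    rw [hX, encard_insert_of_notMem (by simp [rim]), encard_sdiff_singleton_add_one
      (show Sum.inr j ∈ rim r \ {Sum.inr i} from ⟨⟨j, rfl⟩, by simpa using hij.symm⟩),
      encard_sdiff_singleton_add_one (show Sum.inr i ∈ rim r from ⟨i, rfl⟩), encard_rim]
  have h4 : X.encard ≠ ⊤ := encard_ne_top_iff.2 (toFinite _)
  rw [← h3] at h2
  exact absurd h2 (not_le.2 ((ENat.lt_add_one_iff h4).2 le_rfl))

/-- Parallelism passes from one neighbouring pair to the next, hence holds for all neighbouring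
pairs, and it is transitive. -/
theorem IsFan.not_indep_spokes (h : IsFan M) (hr : 2 ≤ r) {i : Fin r}
    (hi : ¬ M.Indep {Sum.inl i, Sum.inl (finRotate r i)}) {j k : Fin r} (hjk : j ≠ k) :
    ¬ M.Indep {Sum.inl j, Sum.inl k} := by
  have hall : {i | ¬ M.Indep {Sum.inl i, Sum.inl (finRotate r i)}} = univ :=
    eq_univ_of_finRotate_closed ⟨i, hi⟩ fun k hk => h.not_indep_rotate hr hk
  have hT : {k | Sum.inl k ∈ M.closure {Sum.inl j}} = univ := by
    refine eq_univ_of_finRotate_closed ⟨j, M.mem_closure_of_mem' rfl (by simp [h.ground])⟩ ?_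
    intro k hk
    have hk' : k ∈ {i | ¬ M.Indep {Sum.inl i, Sum.inl (finRotate r i)}} := hall ▸ mem_univ k
    refine M.closure_subset_closure_of_subset_closure (singleton_subset_iff.2 hk) ?_
    exact mem_closure_of_insert_not_indep (h.indep_singleton k) (by simp [h.ground])
      (by rw [pair_comm]; exact hk')
  have hk : k ∈ {k | Sum.inl k ∈ M.closure {Sum.inl j}} := hT ▸ mem_univ k
  rw [mem_ofPred_eq, (h.indep_singleton j).mem_closure_iff_of_notMem (by simpa using hjk.symm)] at hk
  rw [pair_comm]
  exact hk.not_indep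

theorem exists_spoke_mem {B : Set (Fin r ⊕ Fin r)} (hB : B.encard = r) (hne : B ≠ rim r) :
    ∃ i, Sum.inl i ∈ B := by
  by_contra! hcon
  apply hne
  refine (toFinite B).eq_of_subset_of_encard_le ?_ (by rw [hB, encard_rim])
  rintro (i | i) hi
  · exact absurd hi (hcon i)
  · exact ⟨i, rfl⟩

/-- With parallel spokes a base contains at most one spoke. If it is not the rim it contains exactly
one, hence all rim elements but one, and such sets are bases by definition of `IsFan`. -/
theorem IsFan.isBase_of_isBase_of_parallel (h : IsFan M) (h' : IsFan M') (hr : 2 ≤ r) {i : Fin r}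
    (hi : ¬ M.Indep {Sum.inl i, Sum.inl (finRotate r i)}) {B : Set (Fin r ⊕ Fin r)}
    (hB : M.IsBase B) (hne : B ≠ rim r) : M'.IsBase B := by
  have hc := h.encard_eq hr hB
  obtain ⟨k, hk⟩ := exists_spoke_mem hc hne
  have hsub : B \ {Sum.inl k} ⊆ rim r := by
    rintro (j | j) ⟨hj, hjk⟩
    · exact absurd (hB.indep.subset (pair_subset hj hk))
        (h.not_indep_spokes hr hi (by simpa using hjk))
    · exact ⟨j, rfl⟩
  have hc' := encard_sdiff_singleton_add_one hk
  have hne' : B \ {Sum.inl k} ≠ rim r := by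
    intro he
    rw [he, encard_rim, hc] at hc'
    exact absurd hc'.le (not_le.2 ((ENat.lt_add_one_iff (by simp)).2 le_rfl))
  obtain ⟨_, ⟨j, rfl⟩, hj⟩ := exists_of_ssubset (hsub.ssubset_of_ne hne')
  have hBe : insert (Sum.inl k) (rim r \ {Sum.inr j}) = B := by
    symm
    refine (toFinite B).eq_of_subset_of_encard_le ?_ (by rw [hc, encard_insert_rim_sdiff])
    intro x hx
    by_cases hxk : x = Sum.inl k
    · exact .inl hxk
    · exact .inr ⟨hsub ⟨hx, hxk⟩, fun hxj => hj (hxj ▸ ⟨hx, hxk⟩)⟩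
  exact hBe ▸ h'.isBase k j

theorem IsFan.indep_pair (h : IsFan M) (hr : 2 ≤ r) {i j : Fin r}
    (hi : M.Indep {Sum.inl i, Sum.inl j}) (hij : i ≠ j) (k : Fin r) :
    M.Indep {Sum.inl k, Sum.inl (finRotate r k)} := by
  by_contra hn
  exact h.not_indep_spokes hr hn hij hi

theorem encard_spokes : (range (Sum.inl : Fin r → Fin r ⊕ Fin r)).encard = r := by
  rw [← image_univ, Sum.inl_injective.encard_image, encard_univ]
  simp

theorem IsFan.isBase_spokes (h : IsFan M) (hr : 2 ≤ r) {i j : Fin r}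
    (hi : M.Indep {Sum.inl i, Sum.inl j}) (hij : i ≠ j) :
    M.IsBase (range Sum.inl) := by
  have hE : range Sum.inl ⊆ M.E := by simp [h.ground]
  refine isBase_of_base_subset_closure (h.isBase i i) (toFinite _) hE ?_
    (by rw [encard_spokes, encard_insert_rim_sdiff])
  rintro (k | k) -
  · exact M.mem_closure_of_mem ⟨k, rfl⟩
  · refine M.closure_subset_closure ?_ (h.rim_mem_closure (h.indep_pair hr hi hij k))
    exact pair_subset ⟨_, rfl⟩ ⟨_, rfl⟩

/-- If `B` does not span all spokes in `M'`, the set `T` of spokes it does span there, with the rim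
elements away from `T`, has fewer than `r` elements and yet spans `B` in `M`. -/
theorem IsFan.isBase_of_isBase_of_not_parallel (h : IsFan M) (h' : IsFan M') (hr : 2 ≤ r)
    {i j : Fin r} (hi : M.Indep {Sum.inl i, Sum.inl j}) (hi' : M'.Indep {Sum.inl i, Sum.inl j})
    (hij : i ≠ j) {B : Set (Fin r ⊕ Fin r)}
    (hB : M.IsBase B) (hne : B ≠ rim r) : M'.IsBase B := by
  have hc := h.encard_eq hr hB
  obtain ⟨k, hk⟩ := exists_spoke_mem hc hne
  have hBE : B ⊆ M'.E := by simp [h'.ground]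
  have hBcl := M'.subset_closure B
  set T : Set (Fin r) := {j | Sum.inl j ∈ M'.closure B} with hT
  by_cases hTu : T = univ
  · refine isBase_of_base_subset_closure (h'.isBase_spokes hr hi' hij) (toFinite _) hBE ?_
      (by rw [hc, encard_spokes])
    rintro _ ⟨m, rfl⟩
    have : m ∈ T := hTu ▸ mem_univ m
    exact this
  exfalso
  have hTn : Tᶜ.Nonempty := nonempty_compl.2 hTu
  set U : Set (Fin r) := {j | j ∉ T ∧ finRotate r j ∉ T} with hU
  -- Equality would make the complement of `T` closed under rotation, hence everything, whereas `B`
  -- contains the spoke `k`.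
  have hUT : U ⊂ Tᶜ := by
    refine ssubset_of_subset_of_ne (fun x hx => hx.1) fun he => ?_
    have := eq_univ_of_finRotate_closed hTn fun x hx => by
      rw [← he] at hx
      exact hx.2
    have hkT : k ∈ Tᶜ := this ▸ mem_univ k
    exact hkT (hBcl hk)
  have hcard : (Sum.inl '' T ∪ Sum.inr '' U : Set (Fin r ⊕ Fin r)).encard < r := by
    calc _ ≤ (Sum.inl '' T : Set (Fin r ⊕ Fin r)).encard
          + (Sum.inr '' U : Set (Fin r ⊕ Fin r)).encard := encard_union_le _ _
      _ = T.encard + U.encard := by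
        rw [Sum.inl_injective.encard_image, Sum.inr_injective.encard_image]
      _ < T.encard + Tᶜ.encard := by
        refine (ENat.add_lt_add_iff_left (encard_ne_top_iff.2 (toFinite _))).2 ?_
        exact (toFinite _).encard_lt_encard hUT
      _ = r := by rw [encard_add_encard_compl, encard_univ]; simp
  -- A rim element of `B` has both adjacent spokes in `T` or neither. In the first case its triangle
  -- spans it in `M`; in the second it belongs to `U`.
  have hsub : B ⊆ M.closure (Sum.inl '' T ∪ Sum.inr '' U) := by
    have hY : Sum.inl '' T ∪ Sum.inr '' U ⊆ M.E := by simp [h.ground]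
    rintro (m | m) hm
    · exact M.mem_closure_of_mem (.inl ⟨m, hBcl hm, rfl⟩)
    · by_cases hmT : m ∈ T
      · have hmT' : finRotate r m ∈ T := (h'.spoke_mem_closure_iff hr (hBcl hm)).1 hmT
        refine M.closure_subset_closure ?_ (h.rim_mem_closure (h.indep_pair hr hi hij m))
        exact pair_subset (.inl ⟨_, hmT, rfl⟩) (.inl ⟨_, hmT', rfl⟩)
      · refine M.mem_closure_of_mem (.inr ⟨m, ⟨hmT, fun hmT' => hmT ?_⟩, rfl⟩)
        exact (h'.spoke_mem_closure_iff hr (hBcl hm)).2 hmT'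
  have h1 := hB.indep.encard_le_eRk_of_subset hsub
  rw [M.eRk_closure_eq, hc] at h1
  exact absurd (h1.trans (M.eRk_le_encard _)) (not_le.2 hcard)

/-- A matroid satisfying `IsFan` is determined by whether the spokes are parallel and by
whether the rim is a base. -/
theorem IsFan.eq_of_iff (h : IsFan M) (h' : IsFan M') (hr : 2 ≤ r) {i : Fin r}
    (hi : M.Indep {Sum.inl i, Sum.inl (finRotate r i)} ↔
      M'.Indep {Sum.inl i, Sum.inl (finRotate r i)})
    (hrim : M.IsBase (rim r) ↔ M'.IsBase (rim r)) : M = M' := by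
  refine Matroid.ext_isBase (h.ground.trans h'.ground.symm) fun B _ => ?_
  by_cases hne : B = rim r
  · rw [hne, hrim]
  by_cases hp : M.Indep {Sum.inl i, Sum.inl (finRotate r i)}
  · have hij := (finRotate_ne_self hr i).symm
    exact ⟨fun hB => h.isBase_of_isBase_of_not_parallel h' hr hp (hi.1 hp) hij hB hne,
      fun hB => h'.isBase_of_isBase_of_not_parallel h hr (hi.1 hp) hp hij hB hne⟩
  · exact ⟨fun hB => h.isBase_of_isBase_of_parallel h' hr hp hB hne,
      fun hB => h'.isBase_of_isBase_of_parallel h hr (fun hn => hp (hi.2 hn)) hB hne⟩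

end Fan

/-! ### The four matroids are fan matroids and realize all values of the two bits. -/

section Four

open Set

variable {r : ℕ}

/-- The circuit `X` is spanned by `X \ {f}` and is a flat, so an element outside `X` raises the rank
of `X \ {f}` to that of the matroid. -/
theorem IsCircuitHyperplane.isBase_insert_sdiff {β : Type*} {M : Matroid β} {X : Set β}
    (h : IsCircuitHyperplane M X) (hX : X.Finite) {e f : β} (he : e ∈ M.E) (heX : e ∉ X)
    (hf : f ∈ X) : M.IsBase (insert e (X \ {f})) := by
  obtain ⟨hC, hF, hr⟩ := h
  have hI := hC.sdiff_singleton_indep hf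
  have hecl : e ∉ M.closure (X \ {f}) := by
    rw [hC.closure_sdiff_singleton_eq, hF.closure]
    exact heX
  have hins : M.Indep (insert e (X \ {f})) :=
    (hI.insert_indep_iff_of_notMem (fun h => heX h.1)).2 ⟨he, hecl⟩
  refine hins.isBase_of_eRk_ge ((hX.subset sdiff_subset).insert e) ?_
  rw [hins.eRk_eq_encard, encard_insert_of_notMem (fun h => heX h.1),
    encard_sdiff_singleton_add_one hf, ← hr, hC.eRk_add_one_eq]

theorem isFan_of_isCircuitHyperplane {M : Matroid (Fin r ⊕ Fin r)} (hE : M.E = univ)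
    (hrim : IsCircuitHyperplane M (rim r))
    (htri : ∀ i, ¬ M.Indep {Sum.inl i, Sum.inr i, Sum.inl (finRotate r i)}) : IsFan M where
  ground := hE
  not_indep_tri := htri
  isBase i j := hrim.isBase_insert_sdiff (toFinite _) (by simp [hE]) (by simp [rim]) ⟨j, rfl⟩

theorem not_isForest_of_edgeJoined {V β : Type*} {G : Graph V β} {F : Set β} {e : β} {x y : V}
    (he : e ∈ F) (hl : G.IsLink e x y) (hj : EdgeJoined G (F \ {e}) x y) : ¬ IsForest G F :=
  fun h => h.2 e he x y hl hj

theorem isFan_wheelGraph (hr : 2 ≤ r) : IsFan (cycleMatroid (wheelGraph r)) := by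
  refine isFan_of_isCircuitHyperplane rfl (rim_isCircuitHyperplane_wheelGraph (by omega)) ?_
  intro i
  refine not_isForest_of_edgeJoined (e := Sum.inr i) (x := some i) (y := some (finRotate r i))
    (by simp) rfl ?_
  refine Relation.ReflTransGen.trans (b := none) ?_ ?_
  · exact EdgeJoined.of_link (e := Sum.inl i) (by simp) Sym2.eq_swap
  · exact EdgeJoined.of_link (e := Sum.inl (finRotate r i)) (by simp) rfl

theorem not_indep_spokes_graphN {i j : Fin r} (hij : i ≠ j) :
    ¬ (cycleMatroid (graphN r)).Indep {Sum.inl i, Sum.inl j} := by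
  refine not_isForest_of_edgeJoined (e := Sum.inl i) (x := none) (y := some ⟨0, i.pos⟩)
    (by simp) rfl ?_
  exact EdgeJoined.of_link (e := Sum.inl j) (by simpa using hij.symm) rfl

theorem isFan_graphN (hr : 2 ≤ r) : IsFan (cycleMatroid (graphN r)) := by
  refine isFan_of_isCircuitHyperplane rfl (rim_isCircuitHyperplane_graphN (by omega)) ?_
  intro i hi
  exact not_indep_spokes_graphN (finRotate_ne_self hr i).symm
    (hi.subset (pair_subset (by simp) (by simp)))

theorem indep_spokes_wheelGraph {i j : Fin r} (hij : i ≠ j) :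
    (cycleMatroid (wheelGraph r)).Indep {Sum.inl i, Sum.inl j} := by
  change IsForest _ _
  have h0 : IsForest (wheelGraph r) ∅ := ⟨empty_subset _, by simp⟩
  have hnot : ∀ (F : Set (Fin r ⊕ Fin r)) (k : Fin r), (∀ e ∈ F, e = Sum.inl j) → k ≠ j →
      ¬ EdgeJoined (wheelGraph r) F none (some k) := by
    intro F k hF hk hjoin
    have := hjoin.eq_of_isolated fun e he z hl => by
      rw [hF e he] at hl
      change s(z, some k) = s(none, some j) at hl
      simp only [Sym2.eq_iff, Option.some.injEq, reduceCtorEq, and_false, or_false] at hl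
      exact hk hl.2
    simp at this
  have h1 : IsForest (wheelGraph r) {Sum.inl j} := by
    rw [← insert_empty_eq]
    refine h0.insert (u := none) (v := some j) rfl fun hjoin => ?_
    have := hjoin.eq_of_isolated (by simp)
    simp at this
  exact h1.insert (u := none) (v := some i) rfl (hnot _ i (by simp) hij)

section Relax

variable {M N : Matroid (Fin r ⊕ Fin r)}

/-- The base gained by relaxing is the rim, which contains no spoke. -/
theorem indep_iff_of_relax (hN : ∀ B, N.IsBase B ↔ M.IsBase B ∨ B = rim r)
    {I : Set (Fin r ⊕ Fin r)} {i : Fin r} (hi : Sum.inl i ∈ I) : N.Indep I ↔ M.Indep I := by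
  rw [Matroid.indep_iff, Matroid.indep_iff]
  constructor
  · rintro ⟨B, hB, hIB⟩
    rcases (hN B).1 hB with hB | rfl
    · exact ⟨B, hB, hIB⟩
    · obtain ⟨x, hx⟩ := hIB hi
      simp at hx
  · rintro ⟨B, hB, hIB⟩
    exact ⟨B, (hN B).2 (.inl hB), hIB⟩

theorem IsFan.of_relax (h : IsFan M) (hE : N.E = univ)
    (hN : ∀ B, N.IsBase B ↔ M.IsBase B ∨ B = rim r) : IsFan N where
  ground := hE
  not_indep_tri i := by
    rw [indep_iff_of_relax hN (i := i) (by simp)]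
    exact h.not_indep_tri i
  isBase i j := (hN _).2 (.inl (h.isBase i j))

end Relax

theorem isFan_whirl (hr : 2 ≤ r) : IsFan (whirl r) :=
  (isFan_wheelGraph hr).of_relax rfl (whirl_isBase_iff (by omega))

theorem isFan_relaxedN (hr : 2 ≤ r) : IsFan (relaxedN r) :=
  (isFan_graphN hr).of_relax rfl (relaxedN_isBase_iff (by omega))

theorem indep_spokes_whirl (hr : 1 ≤ r) {i j : Fin r} (hij : i ≠ j) :
    (whirl r).Indep {Sum.inl i, Sum.inl j} := by
  rw [indep_iff_of_relax (whirl_isBase_iff hr) (i := i) (by simp)]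
  exact indep_spokes_wheelGraph hij

theorem not_indep_spokes_relaxedN (hr : 1 ≤ r) {i j : Fin r} (hij : i ≠ j) :
    ¬ (relaxedN r).Indep {Sum.inl i, Sum.inl j} := by
  rw [indep_iff_of_relax (relaxedN_isBase_iff hr) (i := i) (by simp)]
  exact not_indep_spokes_graphN hij

theorem not_isBase_rim_wheelGraph (hr : 1 ≤ r) :
    ¬ (cycleMatroid (wheelGraph r)).IsBase (rim r) :=
  fun h => (rim_isCircuitHyperplane_wheelGraph hr).1.not_indep h.indep

theorem not_isBase_rim_graphN (hr : 1 ≤ r) :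
    ¬ (cycleMatroid (graphN r)).IsBase (rim r) :=
  fun h => (rim_isCircuitHyperplane_graphN hr).1.not_indep h.indep

/-- The four matroids `M(N_r)`, `N^r`, `M(W_r)` and `W^r`. -/
def fanMatroid (r : ℕ) : Fin 4 → Matroid (Fin r ⊕ Fin r) :=
  ![cycleMatroid (graphN r), relaxedN r, cycleMatroid (wheelGraph r), whirl r]

theorem isFan_fanMatroid (hr : 2 ≤ r) (j : Fin 4) : IsFan (fanMatroid r j) := by
  fin_cases j
  exacts [isFan_graphN hr, isFan_relaxedN hr, isFan_wheelGraph hr, isFan_whirl hr]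

theorem indep_spokes_fanMatroid_iff (hr : 1 ≤ r) {i j : Fin r} (hij : i ≠ j) (k : Fin 4) :
    (fanMatroid r k).Indep {Sum.inl i, Sum.inl j} ↔ 2 ≤ k := by
  fin_cases k
  · exact iff_of_false (not_indep_spokes_graphN hij) (by decide)
  · exact iff_of_false (not_indep_spokes_relaxedN hr hij) (by decide)
  · exact iff_of_true (indep_spokes_wheelGraph hij) (by decide)
  · exact iff_of_true (indep_spokes_whirl hr hij) (by decide)

theorem isBase_rim_fanMatroid_iff (hr : 1 ≤ r) (k : Fin 4) :
    (fanMatroid r k).IsBase (rim r) ↔ k = 1 ∨ k = 3 := by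
  fin_cases k
  · exact iff_of_false (not_isBase_rim_graphN hr) (by decide)
  · exact iff_of_true ((relaxedN_isBase_iff hr _).2 (.inr rfl)) (by decide)
  · exact iff_of_false (not_isBase_rim_wheelGraph hr) (by decide)
  · exact iff_of_true ((whirl_isBase_iff hr _).2 (.inr rfl)) (by decide)

/-- The index encodes the two bits: `2 ≤ k` for non-parallel spokes, `k = 1 ∨ k = 3` for the rim
being a base. -/
theorem fanMatroid_injective (hr : 2 ≤ r) : Function.Injective (fanMatroid r) := by
  intro j k h
  have i : Fin r := ⟨0, by omega⟩
  have hi := (finRotate_ne_self hr i).symm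
  have h1 := (indep_spokes_fanMatroid_iff (by omega) hi j).symm.trans
    (h ▸ indep_spokes_fanMatroid_iff (by omega) hi k)
  have h2 := (isBase_rim_fanMatroid_iff (by omega) j).symm.trans
    (h ▸ isBase_rim_fanMatroid_iff (by omega) k)
  clear h
  revert h1 h2
  revert j k
  decide

theorem IsFan.exists_eq_fanMatroid {M : Matroid (Fin r ⊕ Fin r)} (h : IsFan M) (hr : 2 ≤ r) :
    ∃ k, M = fanMatroid r k := by
  have i : Fin r := ⟨0, by omega⟩
  have hi := (finRotate_ne_self hr i).symm
  have key : ∀ k : Fin 4, (M.Indep {Sum.inl i, Sum.inl (finRotate r i)} ↔ 2 ≤ k) →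
      (M.IsBase (rim r) ↔ k = 1 ∨ k = 3) → M = fanMatroid r k := fun k h1 h2 =>
    h.eq_of_iff (isFan_fanMatroid hr k) hr
      (h1.trans (indep_spokes_fanMatroid_iff (by omega) hi k).symm)
      (h2.trans (isBase_rim_fanMatroid_iff (by omega) k).symm)
  by_cases h1 : M.Indep {Sum.inl i, Sum.inl (finRotate r i)} <;> by_cases h2 : M.IsBase (rim r)
  · exact ⟨3, key 3 (iff_of_true h1 (by decide)) (iff_of_true h2 (by decide))⟩
  · exact ⟨2, key 2 (iff_of_true h1 (by decide)) (iff_of_false h2 (by decide))⟩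
  · exact ⟨1, key 1 (iff_of_false h1 (by decide)) (iff_of_true h2 (by decide))⟩
  · exact ⟨0, key 0 (iff_of_false h1 (by decide)) (iff_of_false h2 (by decide))⟩

end Four

/-! ### Isomorphisms and pairwise non-isomorphism. -/

section Iso

open Set

variable {r : ℕ}

/-- Trades a bijection of subtypes for a labelling of the ground set by `β`, the form in which
isomorphisms are used below. -/
theorem exists_equiv_of_matroidIso {α β : Type*} {M : Matroid α} {N : Matroid β}
    (hN : N.E = univ) (h : MatroidIso M N) :
    ∃ f : β → α, ∃ hf : Function.Injective f, M = N.map f hf.injOn := by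
  obtain ⟨e, he⟩ := h
  let f : β → α := fun x => (e.symm ⟨x, hN ▸ mem_univ x⟩ : α)
  have hf : Function.Injective f := fun x y hxy => by
    simpa using congrArg Subtype.val (e.symm.injective (Subtype.val_injective hxy))
  have hfe : ∀ B : Set M.E, f '' (Subtype.val '' (e '' B)) = Subtype.val '' B := by
    intro B
    rw [image_image, image_image]
    exact image_congr fun x _ => by simp [f]
  refine ⟨f, hf, Matroid.ext_isBase ?_ fun B hB => ?_⟩
  · rw [Matroid.map_ground, hN, image_univ]
    ext x
    constructor
    · intro hx
      exact ⟨e ⟨x, hx⟩, by simp [f]⟩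
    · rintro ⟨y, rfl⟩
      exact Subtype.coe_prop _
  · lift B to Set M.E using hB
    rw [he, ← hfe B, Matroid.map_image_isBase_iff (by simp [hN])]

theorem matroidIso_map {α β : Type*} {N : Matroid β} (f : β → α) (hf : Function.Injective f) :
    MatroidIso (N.map f hf.injOn) N := by
  let e : N.E ≃ (N.map f hf.injOn).E := Equiv.Set.image f N.E hf
  refine ⟨e.symm, fun B => ?_⟩
  have : Subtype.val '' B = f '' (Subtype.val '' (e.symm '' B)) := by
    rw [image_image, image_image]
    refine image_congr fun x _ => ?_
    obtain ⟨y, rfl⟩ := e.surjective x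
    rw [Equiv.symm_apply_apply]
    rfl
  rw [this, Matroid.map_image_isBase_iff (by simp)]

theorem ncard_isBase_map {α β : Type*} (N : Matroid β) {f : β → α} (hf : Function.Injective f) :
    {B | (N.map f hf.injOn).IsBase B}.ncard = {B | N.IsBase B}.ncard := by
  rw [← (hf.image_injective.injOn (s := {B | N.IsBase B})).ncard_image]
  congr 1
  ext B
  simp only [Matroid.map_isBase_iff, mem_ofPred_eq, mem_image]
  exact ⟨fun ⟨B₀, h, hB⟩ => ⟨B₀, h, hB.symm⟩, fun ⟨B₀, h, hB⟩ => ⟨B₀, h, hB.symm⟩⟩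

/-- Two rim elements lie in a common base because a third one can be left out. For `r = 2` this
fails: the rim of the wheel is then a parallel pair. -/
theorem IsFan.indep_pair_of_three_le {M : Matroid (Fin r ⊕ Fin r)} (h : IsFan M) (hr : 3 ≤ r)
    {i j : Fin r} (hi : M.Indep {Sum.inl i, Sum.inl j}) (hij : i ≠ j) (x y : Fin r ⊕ Fin r) :
    M.Indep {x, y} := by
  have hS := h.isBase_spokes (by omega) hi hij
  rcases x with x | x <;> rcases y with y | y
  · exact hS.indep.subset (pair_subset ⟨_, rfl⟩ ⟨_, rfl⟩)
  · exact h.indep_spoke_rim (by omega) x y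
  · rw [pair_comm]
    exact h.indep_spoke_rim (by omega) y x
  · obtain ⟨k, hk⟩ : ∃ k, k ∉ ({x, y} : Finset (Fin r)) := by
      by_contra! hcon
      have := Finset.card_le_card (s := Finset.univ) (fun k _ => hcon k)
      have h2 : ({x, y} : Finset (Fin r)).card ≤ 2 := Finset.card_le_two
      simp at this
      omega
    simp only [Finset.mem_insert, Finset.mem_singleton, not_or] at hk
    refine (h.isBase x k).indep.subset ?_
    exact pair_subset (.inr ⟨⟨x, rfl⟩, by simpa using Ne.symm hk.1⟩)
      (.inr ⟨⟨y, rfl⟩, by simpa using Ne.symm hk.2⟩)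

/-- An isomorphism may move spokes to rim elements, so the first bit is expressed invariantly: all
pairs are independent, or some pair is not. -/
theorem two_le_iff_of_fanMatroid_eq_map (hr : 3 ≤ r) {j k : Fin 4}
    {f : Fin r ⊕ Fin r → Fin r ⊕ Fin r} (hf : Function.Injective f)
    (h : fanMatroid r j = (fanMatroid r k).map f hf.injOn) : 2 ≤ j ↔ 2 ≤ k := by
  have i : Fin r := ⟨0, by omega⟩
  have hi := (finRotate_ne_self (by omega) i).symm
  have hs : Function.Surjective f := Finite.surjective_of_injective hf
  have hmap : ∀ x y, (fanMatroid r j).Indep {f x, f y} ↔ (fanMatroid r k).Indep {x, y} := by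
    intro x y
    rw [h, ← image_pair, Matroid.map_image_indep_iff 
      (by rw [(isFan_fanMatroid (by omega : 2 ≤ r) k).ground]; exact subset_univ _)]
  constructor
  · intro hj
    rw [← indep_spokes_fanMatroid_iff (by omega) hi, ← hmap]
    exact (isFan_fanMatroid (by omega) j).indep_pair_of_three_le hr
      ((indep_spokes_fanMatroid_iff (by omega) hi j).2 hj) hi _ _
  · intro hk
    rw [← indep_spokes_fanMatroid_iff (by omega) hi]
    obtain ⟨x, hx⟩ := hs (Sum.inl i)
    obtain ⟨y, hy⟩ := hs (Sum.inl (finRotate r i))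
    rw [← hx, ← hy, hmap]
    exact (isFan_fanMatroid (by omega) k).indep_pair_of_three_le hr
      ((indep_spokes_fanMatroid_iff (by omega) hi k).2 hk) hi _ _

theorem ncard_isBase_relax {M N : Matroid (Fin r ⊕ Fin r)} (hM : ¬ M.IsBase (rim r))
    (hN : ∀ B, N.IsBase B ↔ M.IsBase B ∨ B = rim r) :
    {B | N.IsBase B}.ncard = {B | M.IsBase B}.ncard + 1 := by
  rw [← ncard_insert_of_notMem (a := rim r) (s := {B | M.IsBase B}) hM (toFinite _)]
  congr 1
  ext B
  simp [hN, or_comm]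

/-- Independence of all pairs separates `{0, 1}` from `{2, 3}`; within each pair the relaxation has
exactly one base more. -/
theorem eq_of_matroidIso_fanMatroid (hr : 3 ≤ r) (j k : Fin 4)
    (h : MatroidIso (fanMatroid r j) (fanMatroid r k)) : j = k := by
  obtain ⟨f, hf, hjk⟩ := exists_equiv_of_matroidIso (isFan_fanMatroid (by omega) k).ground h
  have h1 := two_le_iff_of_fanMatroid_eq_map hr hf hjk
  have h2 : {B | (fanMatroid r j).IsBase B}.ncard = {B | (fanMatroid r k).IsBase B}.ncard := by
    rw [hjk, ncard_isBase_map _ hf]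
  have hN : {B | (fanMatroid r 1).IsBase B}.ncard = {B | (fanMatroid r 0).IsBase B}.ncard + 1 :=
    ncard_isBase_relax (not_isBase_rim_graphN (by omega)) (relaxedN_isBase_iff (by omega))
  have hW : {B | (fanMatroid r 3).IsBase B}.ncard = {B | (fanMatroid r 2).IsBase B}.ncard + 1 :=
    ncard_isBase_relax (not_isBase_rim_wheelGraph (by omega)) (whirl_isBase_iff (by omega))
  fin_cases j <;> fin_cases k <;> first | rfl | (exfalso; revert h1; decide) | (exfalso; simp only [Fin.zero_eta, Fin.mk_one, Fin.reduceFinMk] at h2; omega)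

end Iso

/-! ### `IsFan` is equivalent to a pattern of spans of cyclic intervals. -/

section Pattern

open Set

variable {r : ℕ}

theorem eq_ofNat [NeZero r] (i : Fin r) : i = Fin.ofNat r i := by
  ext; simp

/-- The spokes and rim elements in their cyclic order `s₀, r₀, s₁, r₁, …`. -/
def fanSeq (r : ℕ) [NeZero r] (k : ℕ) : Fin r ⊕ Fin r :=
  if k % 2 = 0 then Sum.inl (Fin.ofNat r (k / 2)) else Sum.inr (Fin.ofNat r (k / 2))

variable [NeZero r]

theorem fanSeq_two_mul (k : ℕ) : fanSeq r (2 * k) = Sum.inl (Fin.ofNat r k) := by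
  simp [fanSeq]

theorem fanSeq_two_mul_add_one (k : ℕ) : fanSeq r (2 * k + 1) = Sum.inr (Fin.ofNat r k) := by
  have h1 : (2 * k + 1) % 2 ≠ 0 := by omega
  have h2 : (2 * k + 1) / 2 = k := by omega
  rw [fanSeq, if_neg h1, h2]

theorem fanSeq_eq_iff {a b : ℕ} : fanSeq r a = fanSeq r b ↔ a % (2 * r) = b % (2 * r) := by
  have hr : 0 < r := Nat.pos_of_ne_zero (NeZero.ne r)
  have key : ∀ a : ℕ, a % (2 * r) = a % 2 + 2 * (a / 2 % r) := fun a => Nat.mod_mul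
  rw [key, key]
  rcases Nat.even_or_odd' a with ⟨k, rfl | rfl⟩ <;> rcases Nat.even_or_odd' b with ⟨l, rfl | rfl⟩
  · rw [fanSeq_two_mul, fanSeq_two_mul, Sum.inl.injEq, ofNat_eq_ofNat_iff]
    have h1 : 2 * k / 2 = k := by omega
    have h2 : 2 * l / 2 = l := by omega
    rw [h1, h2]
    omega
  · rw [fanSeq_two_mul, fanSeq_two_mul_add_one]
    simp only [reduceCtorEq, false_iff]
    omega
  · rw [fanSeq_two_mul, fanSeq_two_mul_add_one]
    simp only [reduceCtorEq, false_iff]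
    omega
  · rw [fanSeq_two_mul_add_one, fanSeq_two_mul_add_one, Sum.inr.injEq, ofNat_eq_ofNat_iff]
    have h1 : (2 * k + 1) / 2 = k := by omega
    have h2 : (2 * l + 1) / 2 = l := by omega
    rw [h1, h2]
    omega

theorem fanSeq_add_period (a : ℕ) : fanSeq r (a + 2 * r) = fanSeq r a := by
  rw [fanSeq_eq_iff, Nat.add_mod_right]

theorem exists_fanSeq_add (a : ℕ) (x : Fin r ⊕ Fin r) :
    ∃ m < 2 * r, x = fanSeq r (a + m) := by
  have hr : 0 < r := Nat.pos_of_ne_zero (NeZero.ne r)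
  obtain ⟨k, rfl⟩ : ∃ k, x = fanSeq r k := by
    rcases x with i | i
    · exact ⟨2 * i, by rw [fanSeq_two_mul, ← eq_ofNat]⟩
    · exact ⟨2 * i + 1, by rw [fanSeq_two_mul_add_one, ← eq_ofNat]⟩
  refine ⟨(k + (2 * r - a % (2 * r))) % (2 * r), Nat.mod_lt _ (by omega), ?_⟩
  rw [fanSeq_eq_iff, Nat.add_mod_mod]
  have h1 : a % (2 * r) < 2 * r := Nat.mod_lt _ (by omega)
  have h3 : a + (k + (2 * r - a % (2 * r))) = k + 2 * r * (a / (2 * r) + 1) := by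
    have := Nat.div_add_mod a (2 * r)
    have h4 : 2 * r * (a / (2 * r) + 1) = 2 * r * (a / (2 * r)) + 2 * r := by ring
    omega
  rw [h3, Nat.add_mul_mod_self_left]

theorem fanSeq_add_left_inj {a m m' : ℕ} (hm : m < 2 * r) (hm' : m' < 2 * r) :
    fanSeq r (a + m) = fanSeq r (a + m') ↔ m = m' := by
  rw [fanSeq_eq_iff]
  refine ⟨fun h => ?_, fun h => h ▸ rfl⟩
  have := Nat.ModEq.add_left_cancel' a (show a + m ≡ a + m' [MOD 2 * r] from h)
  rwa [Nat.ModEq, Nat.mod_eq_of_lt hm, Nat.mod_eq_of_lt hm'] at this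

/-- The elements of `M` that are spanned by a cyclic interval preceding them are those
prescribed by the Grassmann necklace of the whirl. -/
def HasFanPattern (M : Matroid (Fin r ⊕ Fin r)) : Prop :=
  ∀ a m, m < 2 * r → (fanSeq r (a + m) ∈ M.closure (fanSeq r '' Ico a (a + m)) ↔
    ((a + m) % 2 = 0 ∧ 2 ≤ m) ∨ ((a + m) % 2 = 1 ∧ 2 * r - 2 ≤ m))

variable {M : Matroid (Fin r ⊕ Fin r)}

theorem image_fanSeq_two_mul (k : ℕ) : fanSeq r '' Ico (2 * k) (2 * k + 2) =
    {Sum.inl (Fin.ofNat r k), Sum.inr (Fin.ofNat r k)} := by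
  have : Ico (2 * k) (2 * k + 2) = {2 * k, 2 * k + 1} := by
    ext x; simp only [mem_Ico, mem_insert_iff, mem_singleton_iff]; omega
  rw [this, image_pair, fanSeq_two_mul, fanSeq_two_mul_add_one]

theorem image_fanSeq_single (k : ℕ) : fanSeq r '' Ico k (k + 1) = {fanSeq r k} := by
  have : Ico k (k + 1) = {k} := by
    ext x; simp only [mem_Ico, mem_singleton_iff]; omega
  rw [this, image_singleton]

theorem notMem_closure_of_insert_indep {α : Type*} {M : Matroid α} {X : Set α} {e : α}
    (h : M.Indep (insert e X)) (he : e ∉ X) : e ∉ M.closure X := by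
  have hX := h.subset (subset_insert _ _)
  rw [hX.notMem_closure_iff_of_notMem he (h.subset_ground (mem_insert _ _))]
  exact h

/-- The `2r - 2` elements preceding a rim element omit only it and the spoke after it. They contain
the base formed by the spoke before it and the other rim elements. -/
theorem IsFan.rim_mem_closure_image (h : IsFan M) {k m : ℕ} (hm : m ≤ 2 * k + 1)
    (hr' : 1 ≤ r) (hm2 : 2 * r - 2 ≤ m) (hm1 : 1 ≤ m) :
    Sum.inr (Fin.ofNat r k) ∈ M.closure (fanSeq r '' Ico (2 * k + 1 - m) (2 * k + 1)) := by
  have hb := h.isBase (Fin.ofNat r k) (Fin.ofNat r k)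
  have : insert (Sum.inl (Fin.ofNat r k)) (rim r \ {Sum.inr (Fin.ofNat r k)}) ⊆
      fanSeq r '' Ico (2 * k + 1 - m) (2 * k + 1) := by
    refine insert_subset ⟨2 * k, by simp only [mem_Ico]; omega, fanSeq_two_mul k⟩ ?_
    rintro _ ⟨⟨i, rfl⟩, hi⟩
    obtain ⟨j, hj, rfl⟩ := exists_ofNat_add (k - (r - 1)) i
    have hjr : j ≠ r - 1 := by
      rintro rfl
      apply hi
      have : k - (r - 1) + (r - 1) = k := by omega
      rw [this]
      rfl
    exact ⟨2 * (k - (r - 1) + j) + 1, by simp only [mem_Ico]; omega, fanSeq_two_mul_add_one _⟩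
  rw [hb.closure_of_superset this, h.ground]
  trivial

/-- The longest such interval starts, up to a period, at the spoke `k + 2`. That spoke and the rim
elements other than `k` and `k + 1` span it, and adding the rim element `k` leaves them independent.
-/
theorem IsFan.rim_notMem_closure_image (h : IsFan M) (hr : 2 ≤ r) {k a : ℕ}
    (ha : 2 * k + 4 ≤ a + 2 * r) :
    Sum.inr (Fin.ofNat r k) ∉ M.closure (fanSeq r '' Ico a (2 * k + 1)) := by
  set X : Set (Fin r ⊕ Fin r) := insert (Sum.inl (Fin.ofNat r (k + 2)))
    ((rim r \ {Sum.inr (Fin.ofNat r k)}) \ {Sum.inr (Fin.ofNat r (k + 1))}) with hX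
  have hne : Fin.ofNat r k ≠ Fin.ofNat r (k + 1) := by
    rw [← finRotate_ofNat]
    exact (finRotate_ne_self hr _).symm
  have hnX : Sum.inr (Fin.ofNat r k) ∉ M.closure X := by
    refine notMem_closure_of_insert_indep ?_ (by simp [hX])
    refine (h.isBase (Fin.ofNat r (k + 2)) (Fin.ofNat r (k + 1))).indep.subset ?_
    refine insert_subset (.inr ⟨⟨_, rfl⟩, by simpa using hne⟩) ?_
    exact insert_subset_insert (sdiff_subset_sdiff_left sdiff_subset)
  have hXE : X ⊆ M.E := by simp [h.ground]
  have hcl := M.subset_closure X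
  have hrim : ∀ t, t + 2 < r → Sum.inr (Fin.ofNat r (k + (t + 2))) ∈ M.closure X := by
    intro t ht
    refine hcl (.inr ⟨⟨⟨_, rfl⟩, ?_⟩, ?_⟩)
    · simp only [mem_singleton_iff, Sum.inr.injEq]
      rw [show Fin.ofNat r k = Fin.ofNat r (k + 0) from rfl,
        ofNat_add_left_inj (by omega) (by omega)]
      omega
    · simp only [mem_singleton_iff, Sum.inr.injEq]
      rw [ofNat_add_left_inj (by omega) (by omega)]
      omega
  have hspoke : ∀ t, t + 2 ≤ r → Sum.inl (Fin.ofNat r (k + (t + 2))) ∈ M.closure X := by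
    intro t
    induction t with
    | zero => intro _; exact hcl (mem_insert _ _)
    | succ t ih =>
      intro ht
      have := (h.spoke_mem_closure_iff hr (hrim t (by omega))).1 (ih (by omega))
      rwa [finRotate_ofNat] at this
  refine fun hmem => hnX (M.closure_subset_closure_of_subset_closure ?_ hmem)
  rintro _ ⟨j, ⟨hj1, hj2⟩, rfl⟩
  rcases Nat.even_or_odd' j with ⟨l, rfl | rfl⟩
  -- Shifting by a period makes the index at least `k + 2`, so that the natural-number subtraction
  -- below is exact.
  · rw [← fanSeq_add_period, ← mul_add, fanSeq_two_mul]
    have := hspoke (l + r - (k + 2)) (by omega)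
    rwa [show k + (l + r - (k + 2) + 2) = l + r by omega] at this
  · rw [← fanSeq_add_period, show 2 * l + 1 + 2 * r = 2 * (l + r) + 1 by ring,
      fanSeq_two_mul_add_one]
    have := hrim (l + r - (k + 2)) (by omega)
    rwa [show k + (l + r - (k + 2) + 2) = l + r by omega] at this

theorem IsFan.hasFanPattern (h : IsFan M) (hr : 2 ≤ r) : HasFanPattern M := by
  intro a m hm
  rcases Nat.even_or_odd' (a + m) with ⟨k, hk | hk⟩
  · have : (((a + m) % 2 = 0 ∧ 2 ≤ m) ∨ ((a + m) % 2 = 1 ∧ 2 * r - 2 ≤ m)) ↔ 2 ≤ m := by omega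
    rw [this, hk, fanSeq_two_mul]
    constructor
    · intro hmem
      by_contra! hlt
      interval_cases m
      · obtain rfl : a = 2 * k := by omega
        rw [Ico_self, image_empty] at hmem
        refine notMem_closure_of_insert_indep ?_ (notMem_empty _) hmem
        simpa using h.indep_singleton _
      · obtain ⟨l, rfl⟩ : ∃ l, k = l + 1 := ⟨k - 1, by omega⟩
        obtain rfl : a = 2 * l + 1 := by omega
        rw [show 2 * (l + 1) = 2 * l + 1 + 1 by ring, image_fanSeq_single,
          fanSeq_two_mul_add_one] at hmem
        exact notMem_closure_of_insert_indep (h.indep_spoke_rim hr _ _) (by simp) hmem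
    · intro h2
      obtain ⟨l, rfl⟩ : ∃ l, k = l + 1 := ⟨k - 1, by omega⟩
      have hn := h.next hr (Fin.ofNat r l)
      rw [finRotate_ofNat, ← image_fanSeq_two_mul] at hn
      refine M.closure_subset_closure (image_mono (Ico_subset_Ico ?_ ?_)) hn <;> omega
  · have : (((a + m) % 2 = 0 ∧ 2 ≤ m) ∨ ((a + m) % 2 = 1 ∧ 2 * r - 2 ≤ m)) ↔
        2 * r - 2 ≤ m := by omega
    rw [this, hk, fanSeq_two_mul_add_one]
    constructor
    · intro hmem
      by_contra! hlt
      exact h.rim_notMem_closure_image hr (by omega) hmem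
    · intro h2
      have := h.rim_mem_closure_image (k := k) (m := m) (by omega) (by omega) h2 (by omega)
      rwa [show 2 * k + 1 - m = a by omega] at this

theorem HasFanPattern.next (h : HasFanPattern M) (hr : 2 ≤ r) (k : ℕ) :
    Sum.inl (Fin.ofNat r (k + 1)) ∈
      M.closure {Sum.inl (Fin.ofNat r k), Sum.inr (Fin.ofNat r k)} := by
  have := (h (2 * k) 2 (by omega)).2 (.inl ⟨by omega, le_rfl⟩)
  rwa [image_fanSeq_two_mul, show 2 * k + 2 = 2 * (k + 1) by ring, fanSeq_two_mul] at this

/-- Closure exchange applied to `next`: the interval consisting of the rim element alone, of length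
one, does not span the following spoke. -/
theorem HasFanPattern.prev (h : HasFanPattern M) (hr : 2 ≤ r) (k : ℕ) :
    Sum.inl (Fin.ofNat r k) ∈
      M.closure {Sum.inl (Fin.ofNat r (k + 1)), Sum.inr (Fin.ofNat r k)} := by
  refine Matroid.closure_exchange (X := {Sum.inr (Fin.ofNat r k)}) ⟨h.next hr k, fun hn => ?_⟩ |>.1
  have := (h (2 * k + 1) 1 (by omega)).1
  rw [image_fanSeq_single, show 2 * k + 1 + 1 = 2 * (k + 1) by ring, fanSeq_two_mul,
    fanSeq_two_mul_add_one] at this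
  have := this hn
  omega

theorem rim_sdiff_eq_image (hr : 1 ≤ r) (k : ℕ) : rim r \ {Sum.inr (Fin.ofNat r k)} =
    (fun j => Sum.inr (Fin.ofNat r j)) '' Ico (k + 1) (k + 1 + (r - 1)) := by
  ext x
  constructor
  · rintro ⟨⟨i, rfl⟩, hi⟩
    obtain ⟨m, hm, rfl⟩ := exists_ofNat_add k i
    have hm0 : m ≠ 0 := by rintro rfl; exact hi rfl
    exact ⟨k + m, by simp only [mem_Ico]; omega, rfl⟩
  · rintro ⟨j, ⟨hj1, hj2⟩, rfl⟩
    refine ⟨⟨_, rfl⟩, ?_⟩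
    simp only [mem_singleton_iff, Sum.inr.injEq]
    rw [show j = k + (j - k) by omega, show Fin.ofNat r k = Fin.ofNat r (k + 0) from rfl,
      ofNat_add_left_inj (by omega) (by omega)]
    omega

/-- This is the greedy basis of the order starting at the spoke `k + 1`: that spoke, followed by all
rim elements except the last, which is the rim element `k`. -/
theorem HasFanPattern.isBase_aux (h : HasFanPattern M) (hE : M.E = univ) (hr : 2 ≤ r) (k : ℕ) :
    M.IsBase (insert (Sum.inl (Fin.ofNat r (k + 1))) (rim r \ {Sum.inr (Fin.ofNat r k)})) := by
  rw [rim_sdiff_eq_image (by omega)]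
  set g : ℕ → Fin r ⊕ Fin r := fun j => Sum.inr (Fin.ofNat r j) with hg
  have hgs : ∀ j, g j = fanSeq r (2 * j + 1) := fun j => (fanSeq_two_mul_add_one j).symm
  have hind : ∀ m, m < r → M.Indep (insert (Sum.inl (Fin.ofNat r (k + 1)))
      (g '' Ico (k + 1) (k + 1 + m))) := by
    intro m
    induction m with
    | zero =>
      intro _
      rw [add_zero, Ico_self, image_empty]
      have := (h (2 * (k + 1)) 0 (by omega)).not.2 (by omega)
      rw [add_zero, Ico_self, image_empty, fanSeq_two_mul,
        M.empty_indep.notMem_closure_iff_of_notMem (notMem_empty _) (by simp [hE])] at this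
      exact this
    | succ m ih =>
      intro hm
      have hI := ih (by omega)
      have hset : insert (Sum.inl (Fin.ofNat r (k + 1))) (g '' Ico (k + 1) (k + 1 + (m + 1))) =
          insert (g (k + 1 + m)) (insert (Sum.inl (Fin.ofNat r (k + 1)))
            (g '' Ico (k + 1) (k + 1 + m))) := by
        have : Ico (k + 1) (k + 1 + (m + 1)) = insert (k + 1 + m) (Ico (k + 1) (k + 1 + m)) := by
          ext x; simp only [mem_Ico, mem_insert_iff]; omega
        rw [this, image_insert_eq, insert_comm]
      -- Since `m + 1 < r`, the length `2 * m + 1` is at most `2 * r - 3`, just below the threshold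
      -- for rim elements.
      have hn := (h (2 * (k + 1)) (2 * m + 1) (by omega)).not.2 (by omega)
      rw [show 2 * (k + 1) + (2 * m + 1) = 2 * (k + 1 + m) + 1 by ring, ← hgs] at hn
      rw [hset]
      refine ((hI.notMem_closure_iff (he := by simp [hE])).1 fun hc => hn ?_).1
      refine M.closure_subset_closure ?_ hc
      refine insert_subset ⟨2 * (k + 1), by simp only [mem_Ico]; omega, fanSeq_two_mul _⟩ ?_
      rintro _ ⟨j, ⟨hj1, hj2⟩, rfl⟩
      exact ⟨2 * j + 1, by simp only [mem_Ico]; omega, (hgs j).symm⟩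
  have hI := hind (r - 1) (by omega)
  set X := insert (Sum.inl (Fin.ofNat r (k + 1))) (g '' Ico (k + 1) (k + 1 + (r - 1))) with hX
  have hXcl := M.subset_closure X hI.subset_ground
  have hrim : ∀ t, t + 1 < r → Sum.inr (Fin.ofNat r (k + 1 + t)) ∈ M.closure X := fun t ht =>
    hXcl (.inr ⟨k + 1 + t, by simp only [mem_Ico]; omega, rfl⟩)
  have hspoke : ∀ t, t < r → Sum.inl (Fin.ofNat r (k + 1 + t)) ∈ M.closure X := by
    intro t
    induction t with
    | zero => intro _; exact hXcl (mem_insert _ _)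
    | succ t ih =>
      intro ht
      exact M.closure_subset_closure_of_subset_closure
        (pair_subset (ih (by omega)) (hrim t (by omega))) (h.next hr (k + 1 + t))
  have hlast : Sum.inr (Fin.ofNat r (k + 1 + (r - 1))) ∈ M.closure X := by
    have hn := (h (2 * (k + 1)) (2 * (r - 1) + 1) (by omega)).2 (by omega)
    rw [show 2 * (k + 1) + (2 * (r - 1) + 1) = 2 * (k + 1 + (r - 1)) + 1 by ring,
      fanSeq_two_mul_add_one] at hn
    refine M.closure_subset_closure_of_subset_closure ?_ hn
    rintro _ ⟨j, ⟨hj1, hj2⟩, rfl⟩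
    rcases Nat.even_or_odd' j with ⟨l, rfl | rfl⟩
    · rw [fanSeq_two_mul, show l = k + 1 + (l - (k + 1)) by omega]
      exact hspoke _ (by omega)
    · rw [fanSeq_two_mul_add_one, show l = k + 1 + (l - (k + 1)) by omega]
      exact hrim _ (by omega)
  refine hI.isBase_of_ground_subset_closure ?_
  rintro (i | i) -
  · obtain ⟨m, hm, rfl⟩ := exists_ofNat_add (k + 1) i
    exact hspoke m hm
  · obtain ⟨m, hm, rfl⟩ := exists_ofNat_add (k + 1) i
    rcases Nat.lt_or_ge (m + 1) r with hlt | hge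
    · exact hrim m hlt
    · obtain rfl : m = r - 1 := by omega
      exact hlast

theorem HasFanPattern.isFan (h : HasFanPattern M) (hE : M.E = univ) (hr : 2 ≤ r) : IsFan M where
  ground := hE
  not_indep_tri i hI := by
    have hn := h.next hr i
    rw [← finRotate_ofNat, ← eq_ofNat] at hn
    refine notMem_closure_of_insert_indep (hI.subset ?_) ?_ hn
    · intro x hx
      simp only [mem_insert_iff, mem_singleton_iff] at hx ⊢
      tauto
    · simpa using finRotate_ne_self hr i
  isBase i j := by
    set X : Set (Fin r ⊕ Fin r) := insert (Sum.inl i) (rim r \ {Sum.inr j}) with hX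
    have hXE : X ⊆ M.E := by simp [hE]
    have hXcl := M.subset_closure X
    -- Spokes travel along every rim element except `j`, so all are spanned, in particular the spoke
    -- after `j` in the base given by `isBase_aux`.
    have hT : {k | Sum.inl k ∈ M.closure X} = univ := by
      refine eq_univ_of_finRotate ⟨i, hXcl (mem_insert _ _)⟩ j fun k hk => ?_
      have hkX : Sum.inr k ∈ M.closure X := hXcl (.inr ⟨⟨k, rfl⟩, by simpa using hk⟩)
      have hn := h.next hr k
      have hp := h.prev hr k
      rw [← finRotate_ofNat, ← eq_ofNat] at hn hp
      exact ⟨fun hs => M.closure_subset_closure_of_subset_closure (pair_subset hs hkX) hn,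
        fun hs => M.closure_subset_closure_of_subset_closure (pair_subset hs hkX) hp⟩
    have hb := h.isBase_aux hE hr j
    rw [← finRotate_ofNat, ← eq_ofNat] at hb
    refine isBase_of_base_subset_closure hb (toFinite _) hXE ?_
      (by rw [encard_insert_rim_sdiff, encard_insert_rim_sdiff])
    refine insert_subset ?_ ((subset_insert _ _).trans hXcl)
    have : finRotate r j ∈ {k | Sum.inl k ∈ M.closure X} := hT ▸ mem_univ _
    exact this

end Pattern

/-! ### Cyclic labellings and the reflection of the labels. -/

section Labelling

open Set

variable {r : ℕ}

/-- The index of a label in the cyclic order. -/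
def fanIndex : Fin r ⊕ Fin r → ℕ := Sum.elim (fun i => 2 * i) (fun i => 2 * i + 1)

theorem fanIndex_lt (x : Fin r ⊕ Fin r) : fanIndex x < 2 * r := by
  rcases x with i | i <;> simp only [fanIndex, Sum.elim_inl, Sum.elim_inr] <;> omega

theorem mapEquiv_isBase_iff' {M : Matroid (Fin r ⊕ Fin r)} (e : Equiv.Perm (Fin r ⊕ Fin r))
    {B : Set (Fin r ⊕ Fin r)} : (M.mapEquiv e.symm).IsBase B ↔ M.IsBase (e '' B) := by
  simp

variable {α : Type*} [LinearOrder α]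

/-- Replaces the order on the labelled elements by their ranks `0, …, 2r - 1`, on which cyclic
arguments become arithmetic. -/
theorem exists_position {f : Fin r ⊕ Fin r → α} (hf : Function.Injective f) :
    ∃ u : Fin r ⊕ Fin r → ℕ, (∀ x y, f x < f y ↔ u x < u y) ∧ (∀ x, u x < 2 * r) ∧
      ∀ t < 2 * r, ∃ x, u x = t := by
  have : Fintype (range f) := Fintype.ofFinite _
  have hcard : Fintype.card (range f) = 2 * r := by
    rw [← Nat.card_eq_fintype_card, Nat.card_coe_set_eq, ← image_univ, hf.injOn.ncard_image,
      ncard_univ, Nat.card_sum, Nat.card_fin]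
    ring
  let e := (Fintype.orderIsoFinOfCardEq (range f) hcard).symm
  refine ⟨fun x => e ⟨f x, mem_range_self x⟩, fun x y => ?_, fun x => Fin.is_lt _, fun t ht => ?_⟩
  · rw [← Fin.lt_def, e.lt_iff_lt, Subtype.mk_lt_mk]
  · obtain ⟨⟨_, x, rfl⟩, hx⟩ := e.surjective ⟨t, ht⟩
    exact ⟨x, congrArg Fin.val hx⟩

variable [NeZero r]

/-- The labelling `f` of a subset of a linear order places the labels in the cyclic order
`s₀, r₀, s₁, r₁, …`. -/
def IsCyclicLabelling (f : Fin r ⊕ Fin r → α) : Prop :=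
  ∀ a m, m < 2 * r → {y ∈ range f | CycLT (f (fanSeq r a)) y (f (fanSeq r (a + m)))} =
    f '' (fanSeq r '' Ico a (a + m))

/-- `b` is the cyclic successor of `a` in `{0, …, n - 1}`. -/
def CycSucc (n a b : ℕ) : Prop := b = a + 1 ∨ (a + 1 = n ∧ b = 0)

theorem isCyclicLabelling_of_cycSucc {f : Fin r ⊕ Fin r → α}
    {u : Fin r ⊕ Fin r → ℕ} (hu : ∀ x y, f x < f y ↔ u x < u y) (hlt : ∀ x, u x < 2 * r)
    (hsucc : ∀ k, CycSucc (2 * r) (u (fanSeq r k)) (u (fanSeq r (k + 1)))) :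
    IsCyclicLabelling f := by
  -- Over fewer than `2r` steps the position wraps around at most once.
  have hadd : ∀ a m, m < 2 * r → (u (fanSeq r (a + m)) = u (fanSeq r a) + m ∨
      u (fanSeq r (a + m)) + 2 * r = u (fanSeq r a) + m) := by
    intro a m
    induction m with
    | zero => intro _; left; rfl
    | succ m ih =>
      intro hm
      have h1 := ih (by omega)
      have h2 := hsucc (a + m)
      have h3 := hlt (fanSeq r a)
      have h4 := hlt (fanSeq r (a + m + 1))
      unfold CycSucc at h2
      rw [← add_assoc]
      omega
  have hle : ∀ x y, f x ≤ f y ↔ u x ≤ u y := fun x y => by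
    rw [← not_lt, hu, not_lt]
  have key : ∀ a m j, m < 2 * r → j < 2 * r →
      (CycLT (f (fanSeq r a)) (f (fanSeq r (a + j))) (f (fanSeq r (a + m))) ↔ j < m) := by
    intro a m j hm hj
    have h1 := hadd a m hm
    have h2 := hadd a j hj
    have h3 := hlt (fanSeq r a)
    have h4 := hlt (fanSeq r (a + m))
    have h5 := hlt (fanSeq r (a + j))
    unfold CycLT
    rw [hu, hu, hle]
    omega
  intro a m hm
  ext y
  constructor
  · rintro ⟨⟨x, rfl⟩, hy⟩
    obtain ⟨j, hj, rfl⟩ := exists_fanSeq_add a x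
    rw [key a m j hm hj] at hy
    exact ⟨_, ⟨a + j, by simp only [mem_Ico]; omega, rfl⟩, rfl⟩
  · rintro ⟨_, ⟨j, ⟨hj1, hj2⟩, rfl⟩, rfl⟩
    refine ⟨mem_range_self _, ?_⟩
    obtain ⟨l, rfl⟩ := Nat.exists_eq_add_of_le hj1
    rw [key a m l hm (by omega)]
    omega

theorem fanSeq_fanIndex (x : Fin r ⊕ Fin r) : fanSeq r (fanIndex x) = x := by
  rcases x with i | i
  · simp only [fanIndex, Sum.elim_inl, fanSeq_two_mul, ← eq_ofNat]
  · simp only [fanIndex, Sum.elim_inr, fanSeq_two_mul_add_one, ← eq_ofNat]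

/-- The reflection of the cyclic order that fixes `s₀`. -/
def fanReflect (x : Fin r ⊕ Fin r) : Fin r ⊕ Fin r := fanSeq r ((2 * r - 1) * fanIndex x)

/-- The factor `2 * r - 1` plays the role of `-1` modulo `2 * r`. -/
theorem fanReflect_fanSeq (k : ℕ) : fanReflect (fanSeq r k) = fanSeq r ((2 * r - 1) * k) := by
  rw [fanReflect, fanSeq_eq_iff]
  exact Nat.ModEq.mul_left _ (fanSeq_eq_iff.1 (fanSeq_fanIndex (fanSeq r k)))

theorem fanReflect_involutive : Function.Involutive (fanReflect (r := r)) := by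
  intro x
  have hr : 0 < r := Nat.pos_of_ne_zero (NeZero.ne r)
  conv_rhs => rw [← fanSeq_fanIndex x]
  rw [← fanSeq_fanIndex x, fanReflect_fanSeq, fanReflect_fanSeq, fanSeq_fanIndex, fanSeq_eq_iff]
  obtain ⟨n, hn⟩ : ∃ n, 2 * r = n + 2 := ⟨2 * r - 2, by omega⟩
  rw [hn, show n + 2 - 1 = n + 1 by omega,
    show (n + 1) * ((n + 1) * fanIndex x) = fanIndex x + (n + 2) * (n * fanIndex x) by ring,
    Nat.add_mul_mod_self_left]

/-- The reflection as a permutation of the labels. -/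
def fanReflectEquiv : Equiv.Perm (Fin r ⊕ Fin r) := fanReflect_involutive.toPerm

theorem fanReflect_add (k j : ℕ) (hj : j ≤ 2 * r) :
    fanReflect (fanSeq r (k + j)) = fanSeq r ((2 * r - 1) * k + (2 * r - j)) := by
  rw [fanReflect_fanSeq, fanSeq_eq_iff]
  have hr : 0 < r := Nat.pos_of_ne_zero (NeZero.ne r)
  rcases Nat.eq_zero_or_pos j with rfl | hj0
  · simp
  obtain ⟨n, rfl⟩ : ∃ n, j = n + 1 := ⟨j - 1, by omega⟩
  have : (2 * r - 1) * (k + (n + 1)) = (2 * r - 1) * k + (2 * r - (n + 1)) + 2 * r * n := by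
    rw [mul_add, add_assoc]
    congr 1
    zify [show 1 ≤ 2 * r by omega, hj]
    ring
  rw [this, Nat.add_mul_mod_self_left]

theorem fanReflect_inl (i : Fin r) : ∃ j, fanReflect (Sum.inl i : Fin r ⊕ Fin r) = Sum.inl j :=
  ⟨Fin.ofNat r ((2 * r - 1) * i), by
    rw [← fanSeq_two_mul, fanReflect, fanIndex, Sum.elim_inl]
    congr 1
    ring⟩

theorem fanReflect_inr (i : Fin r) : ∃ j, fanReflect (Sum.inr i : Fin r ⊕ Fin r) = Sum.inr j :=
  ⟨Fin.ofNat r ((2 * r - 1) * i + (r - 1)), by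
    have hr : 0 < r := Nat.pos_of_ne_zero (NeZero.ne r)
    rw [← fanSeq_two_mul_add_one, fanReflect, fanIndex, Sum.elim_inr]
    congr 1
    rw [mul_add, mul_add, mul_one, add_assoc]
    congr 1
    · ring
    · omega⟩

theorem IsFan.mapEquiv_fanReflect {M : Matroid (Fin r ⊕ Fin r)} (h : IsFan M) :
    IsFan (M.mapEquiv (fanReflectEquiv (r := r)).symm) where
  ground := by simp [h.ground]
  not_indep_tri i := by
    have hr : 0 < r := Nat.pos_of_ne_zero (NeZero.ne r)
    simp only [Matroid.mapEquiv_indep_iff, Equiv.symm_symm]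
    intro hI
    set k := (i : ℕ) with hk
    rw [eq_ofNat i, finRotate_ofNat, ← fanSeq_two_mul, ← fanSeq_two_mul,
      ← fanSeq_two_mul_add_one, image_insert_eq, image_pair] at hI
    have hI' : M.Indep {fanReflect (fanSeq r (2 * k + 0)), fanReflect (fanSeq r (2 * k + 1)),
      fanReflect (fanSeq r (2 * k + 2))} := hI
    rw [fanReflect_add _ _ (by omega), fanReflect_add _ _ (by omega),
      fanReflect_add _ _ (by omega)] at hI'
    -- With this index the triangle at `k` is reflected to the triangle at `l`, with its two spokes
    -- interchanged.
    set l := (2 * r - 1) * k + (r - 1) with hl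
    rw [show (2 * r - 1) * (2 * k) + (2 * r - 0) = 2 * (l + 1) by
        rw [hl, mul_left_comm]; omega,
      show (2 * r - 1) * (2 * k) + (2 * r - 1) = 2 * l + 1 by
        rw [hl, mul_left_comm]; omega,
      show (2 * r - 1) * (2 * k) + (2 * r - 2) = 2 * l by
        rw [hl, mul_left_comm]; omega, fanSeq_two_mul, fanSeq_two_mul, fanSeq_two_mul_add_one,
        ← finRotate_ofNat] at hI'
    refine h.not_indep_tri (Fin.ofNat r l) (hI'.subset ?_)
    intro x hx
    simp only [mem_insert_iff, mem_singleton_iff] at hx ⊢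
    tauto
  isBase i j := by
    rw [mapEquiv_isBase_iff']
    obtain ⟨i', hi⟩ := fanReflect_inl i
    obtain ⟨j', hj⟩ := fanReflect_inr j
    have hrim : fanReflect '' rim r = rim r := by
      refine (toFinite _).eq_of_subset_of_encard_le ?_
        (by rw [fanReflect_involutive.injective.encard_image])
      rintro _ ⟨_, ⟨k, rfl⟩, rfl⟩
      obtain ⟨k', hk⟩ := fanReflect_inr k
      exact ⟨k', hk.symm⟩
    change M.IsBase (fanReflect '' _)
    rw [image_insert_eq, image_sdiff fanReflect_involutive.injective, image_singleton, hi, hj, hrim]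
    exact h.isBase i' j'

end Labelling

/-! ### Separation and adjacency in a cyclic order. -/

section Order

/-- Separation of two pairs on a circle is symmetric in the pairs. -/
theorem not_between_cross {α : Type*} [LinearOrder α] {a b c d : α} (hab : a ≠ b)
    (had : a ≠ d) (hbc : b ≠ c) (hcd : c ≠ d)
    (h : Between b d a ↔ Between b d c) : Between a c b ↔ Between a c d := by
  unfold Between at *
  grind

/-- Two elements of `{0, …, n - 1}` that do not separate the others are cyclically adjacent. -/
theorem cycSucc_or_of_between {n a b : ℕ} (ha : a < n) (hb : b < n) (hab : a ≠ b)
    (h : ∀ x y, x < n → y < n → x ≠ a → x ≠ b → y ≠ a → y ≠ b →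
      (Between a b x ↔ Between a b y)) : CycSucc n a b ∨ CycSucc n b a := by
  unfold CycSucc
  by_contra hcon
  unfold Between at h
  rcases Nat.lt_or_gt_of_ne hab with hlt | hlt
  -- If `a` and `b` are not adjacent, `a + 1` lies between them, while `n - 1` (when `a = 0`) or `0`
  -- (otherwise) lies outside.
  · rcases Nat.eq_zero_or_pos a with h0 | h0
    · have := h (a + 1) (n - 1) (by omega) (by omega) (by omega) (by omega) (by omega) (by omega)
      omega
    · have := h (a + 1) 0 (by omega) (by omega) (by omega) (by omega) (by omega) (by omega)
      omega
  · rcases Nat.eq_zero_or_pos b with h0 | h0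
    · have := h (b + 1) (n - 1) (by omega) (by omega) (by omega) (by omega) (by omega) (by omega)
      omega
    · have := h (b + 1) 0 (by omega) (by omega) (by omega) (by omega) (by omega) (by omega)
      omega

/-- A sequence in which consecutive terms are cyclically adjacent and terms at distance two are
distinct runs through `{0, …, n - 1}` in one direction. -/
theorem cycSucc_direction {n : ℕ} {g : ℕ → ℕ} (hg : ∀ k, g k < n)
    (hadj : ∀ k, CycSucc n (g k) (g (k + 1)) ∨ CycSucc n (g (k + 1)) (g k))
    (hne : ∀ k, g k ≠ g (k + 2)) :
    (∀ k, CycSucc n (g k) (g (k + 1))) ∨ (∀ k, CycSucc n (g (k + 1)) (g k)) := by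
  unfold CycSucc at *
  rcases hadj 0 with h0 | h0
  · left
    intro k
    induction k with
    | zero => exact h0
    | succ k ih =>
      have h1 := hadj (k + 1)
      have h2 := hne k
      have h3 := hg k
      have h4 := hg (k + 1)
      have h5 := hg (k + 1 + 1)
      have h6 : g (k + 2) = g (k + 1 + 1) := rfl
      omega
  · right
    intro k
    induction k with
    | zero => exact h0
    | succ k ih =>
      have h1 := hadj (k + 1)
      have h2 := hne k
      have h3 := hg k
      have h4 := hg (k + 1)
      have h5 := hg (k + 1 + 1)
      have h6 : g (k + 2) = g (k + 1 + 1) := rfl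
      omega

end Order

/-! ### Non-crossing applied to triangles and vertex stars of the wheel. -/

section Geometry

open Set

variable {r : ℕ} {α : Type*} [LinearOrder α] {M : Matroid (Fin r ⊕ Fin r)}
  {f : Fin r ⊕ Fin r → α} {hf : Function.Injective f}

theorem between_iff_of_isPositroid_map (hM : M.E = univ) (hP : IsPositroid (M.map f hf.injOn))
    {Q : Set (Fin r ⊕ Fin r)} {p q b d : Fin r ⊕ Fin r}
    (hp : p ∉ Q) (hq : q ∉ Q) (hb : b ∉ Q) (hd : d ∉ Q)
    (hpb : p ≠ b) (hpd : p ≠ d) (hqb : q ≠ b) (hqd : q ≠ d)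
    (hbase : ∀ z, z = p ∨ z = q → ∀ y, y = b ∨ y = d → M.IsBase (insert z (insert y Q)))
    (hpq : ¬ M.Indep (insert p (insert q Q))) :
    Between (f p) (f q) (f b) ↔ Between (f p) (f q) (f d) := by
  refine hP.between_iff (Q := f '' Q) (by rwa [hf.mem_set_image]) (by rwa [hf.mem_set_image])
    (by rwa [hf.mem_set_image]) (by rwa [hf.mem_set_image])
    (hf.ne hpb) (hf.ne hpd) (hf.ne hqb) (hf.ne hqd) ?_ ?_
  · have key : ∀ z, z = p ∨ z = q → ∀ y, y = b ∨ y = d →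
        (M.map f hf.injOn).IsBase (insert (f z) (insert (f y) (f '' Q))) := by
      intro z hz y hy
      rw [← image_insert_eq, ← image_insert_eq, Matroid.map_image_isBase_iff (by simp [hM])]
      exact hbase z hz y hy
    rintro _ (rfl | rfl) _ (rfl | rfl)
    exacts [key _ (.inl rfl) _ (.inl rfl), key _ (.inl rfl) _ (.inr rfl),
      key _ (.inr rfl) _ (.inl rfl), key _ (.inr rfl) _ (.inr rfl)]
  · rwa [← image_insert_eq, ← image_insert_eq, Matroid.map_image_indep_iff (by simp [hM])]

/-- The elements of a vertex star of the wheel are not separated by a spoke and a rim edge of a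
triangle that avoids the star. -/
theorem between_star (hM : IsFan M) (hP : IsPositroid (M.map f hf.injOn))
    (hS : M.IsBase (range Sum.inl)) {u v i j : Fin r} (huv : u ≠ v)
    (htri : ¬ M.Indep {Sum.inl u, Sum.inr i, Sum.inl v})
    (hcl : Sum.inl u ∈ M.closure {Sum.inl v, Sum.inr i}) (hju : j ≠ u) (hjv : j ≠ v)
    {b d : Fin r ⊕ Fin r} (hbi : b ≠ Sum.inr i) (hdi : d ≠ Sum.inr i)
    (hb : b ∉ Sum.inl '' {j}ᶜ) (hd : d ∉ Sum.inl '' {j}ᶜ)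
    (hbj : Sum.inl j ∈ M.closure (insert b (Sum.inl '' {j}ᶜ)))
    (hdj : Sum.inl j ∈ M.closure (insert d (Sum.inl '' {j}ᶜ))) :
    Between (f (Sum.inl u)) (f (Sum.inr i)) (f b) ↔
      Between (f (Sum.inl u)) (f (Sum.inr i)) (f d) := by
  set S : Set (Fin r ⊕ Fin r) := Sum.inl '' {j}ᶜ with hSdef
  have huS : Sum.inl u ∈ S := ⟨u, by simpa using hju.symm, rfl⟩
  have hvS : Sum.inl v ∈ S \ {Sum.inl u} :=
    ⟨⟨v, by simpa using hjv.symm, rfl⟩, by simpa using huv.symm⟩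
  have hScard : S.encard + 1 = r := by
    rw [hSdef, Sum.inl_injective.encard_image,
      ← encard_singleton j, add_comm, encard_add_encard_compl, encard_univ]
    simp
  have hne : ∀ y, y ∉ S → Sum.inl u ≠ y := fun y hy h => hy (h ▸ huS)
  -- The set contracted is all spokes but those at `j` and `u`. It contains the spoke `v`, so the
  -- triangle makes the spoke `u` and the rim element `i` parallel, while `b` and `d` still span the
  -- missing spoke `j`.
  refine between_iff_of_isPositroid_map (hf := hf) hM.ground hP (Q := S \ {Sum.inl u})
    (fun h => h.2 rfl) ?_ (fun h => hb h.1) (fun h => hd h.1) (hne b hb) (hne d hd)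
    hbi.symm hdi.symm ?_ ?_
  · rintro ⟨⟨_, _, h⟩, _⟩
    simp at h
  · intro z hz y hy
    have hyj : Sum.inl j ∈ M.closure (insert y S) := by
      rcases hy with rfl | rfl <;> assumption
    set X := insert z (insert y (S \ {Sum.inl u})) with hX
    have hXE : X ⊆ M.E := by simp [hM.ground]
    have hXcl := M.subset_closure X
    have huX : Sum.inl u ∈ M.closure X := by
      rcases hz with rfl | rfl
      · exact hXcl (mem_insert _ _)
      · exact M.closure_subset_closure
          (pair_subset (.inr (.inr hvS)) (mem_insert _ _)) hcl
    have hSX : S ⊆ M.closure X := by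
      intro x hx
      by_cases hxu : x = Sum.inl u
      · exact hxu ▸ huX
      · exact hXcl (.inr (.inr ⟨hx, hxu⟩))
    have hjX : Sum.inl j ∈ M.closure X :=
      M.closure_subset_closure_of_subset_closure
        (insert_subset (hXcl (.inr (mem_insert _ _))) hSX) hyj
    refine isBase_of_base_subset_closure hS (toFinite _) hXE ?_ ?_
    · rintro _ ⟨k, rfl⟩
      by_cases hkj : k = j
      · exact hkj ▸ hjX
      · exact hSX ⟨k, hkj, rfl⟩
    · rw [encard_spokes, ← hScard, ← encard_sdiff_singleton_add_one huS]
      refine (encard_insert_le _ _).trans (add_le_add_left ?_ 1)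
      exact encard_insert_le _ _
  · refine fun hI => htri (hI.subset ?_)
    rintro x (rfl | rfl | rfl)
    · exact mem_insert _ _
    · exact .inr (mem_insert _ _)
    · exact .inr (.inr hvS)

variable [NeZero r]

/-- The elements outside a triangle of the wheel are not separated by a spoke and a rim edge of
the triangle. -/
theorem between_outside (hM : IsFan M) (hr : 3 ≤ r) (hP : IsPositroid (M.map f hf.injOn))
    (hS : M.IsBase (range Sum.inl)) (k : ℕ) {u v : Fin r}
    (huv : u = Fin.ofNat r k ∧ v = Fin.ofNat r (k + 1) ∨
      u = Fin.ofNat r (k + 1) ∧ v = Fin.ofNat r k)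
    {m : ℕ} (hm3 : 3 ≤ m) (hm : m < 2 * r) :
    Between (f (Sum.inl u)) (f (Sum.inr (Fin.ofNat r k))) (f (fanSeq r (2 * k + m))) ↔
      Between (f (Sum.inl u)) (f (Sum.inr (Fin.ofNat r k))) (f (fanSeq r (2 * k + 3))) := by
  have hr2 : 2 ≤ r := by omega
  have hrot : ∀ l, finRotate r (Fin.ofNat r l) = Fin.ofNat r (l + 1) := finRotate_ofNat
  have hkk : Fin.ofNat r k ≠ Fin.ofNat r (k + 1) := by
    rw [← hrot]; exact (finRotate_ne_self hr2 _).symm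
  have huv' : u ≠ v := by
    rcases huv with ⟨rfl, rfl⟩ | ⟨rfl, rfl⟩
    exacts [hkk, hkk.symm]
  have htri : ¬ M.Indep {Sum.inl u, Sum.inr (Fin.ofNat r k), Sum.inl v} := by
    have := hM.not_indep_tri (Fin.ofNat r k)
    rw [hrot] at this
    rcases huv with ⟨rfl, rfl⟩ | ⟨rfl, rfl⟩
    · exact this
    · refine fun hI => this (hI.subset ?_)
      intro x hx
      simp only [mem_insert_iff, mem_singleton_iff] at hx ⊢
      tauto
  have hcl : Sum.inl u ∈ M.closure {Sum.inl v, Sum.inr (Fin.ofNat r k)} := by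
    have h1 := hM.next hr2 (Fin.ofNat r k)
    have h2 := hM.prev hr2 (Fin.ofNat r k)
    rw [hrot] at h1 h2
    rcases huv with ⟨rfl, rfl⟩ | ⟨rfl, rfl⟩
    exacts [h2, h1]
  have hneq : ∀ t, t < r → t ≠ 0 → Fin.ofNat r (k + t) ≠ Fin.ofNat r k := fun t ht ht0 => by
    rw [show Fin.ofNat r k = Fin.ofNat r (k + 0) from rfl, Ne, ofNat_add_left_inj ht (by omega)]
    exact ht0
  -- The three elements form the star of the rim vertex `l + 1`; each of them completes the other
  -- spokes to a spanning set.
  have hspan : ∀ (l : ℕ) (b : Fin r ⊕ Fin r), (b = Sum.inl (Fin.ofNat r (l + 1)) ∨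
      b = Sum.inr (Fin.ofNat r l) ∨ b = Sum.inr (Fin.ofNat r (l + 1))) →
      b ∉ Sum.inl '' ({Fin.ofNat r (l + 1)}ᶜ : Set (Fin r)) ∧ Sum.inl (Fin.ofNat r (l + 1)) ∈
        M.closure (insert b (Sum.inl '' ({Fin.ofNat r (l + 1)}ᶜ : Set (Fin r)))) := by
    intro l b hb
    have hE : insert b (Sum.inl '' ({Fin.ofNat r (l + 1)}ᶜ : Set (Fin r))) ⊆ M.E := by
      simp [hM.ground]
    rcases hb with rfl | rfl | rfl
    · exact ⟨by simp, M.mem_closure_of_mem (mem_insert _ _)⟩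
    · refine ⟨by simp, ?_⟩
      have h1 := hM.next hr2 (Fin.ofNat r l)
      rw [hrot] at h1
      refine M.closure_subset_closure (pair_subset (.inr ⟨_, ?_, rfl⟩) (mem_insert _ _)) h1
      rw [mem_compl_iff, mem_singleton_iff, ← hrot]
      exact (finRotate_ne_self hr2 _).symm
    · refine ⟨by simp, ?_⟩
      have h1 := hM.prev hr2 (Fin.ofNat r (l + 1))
      refine M.closure_subset_closure (pair_subset (.inr ⟨_, ?_, rfl⟩) (mem_insert _ _)) h1
      rw [mem_compl_iff, mem_singleton_iff]
      exact finRotate_ne_self hr2 _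
  have step : ∀ t, t + 2 < r → ∀ b d : Fin r ⊕ Fin r,
      (b = Sum.inl (Fin.ofNat r (k + (t + 1) + 1)) ∨ b = Sum.inr (Fin.ofNat r (k + (t + 1))) ∨
        b = Sum.inr (Fin.ofNat r (k + (t + 1) + 1))) →
      (d = Sum.inl (Fin.ofNat r (k + (t + 1) + 1)) ∨ d = Sum.inr (Fin.ofNat r (k + (t + 1))) ∨
        d = Sum.inr (Fin.ofNat r (k + (t + 1) + 1))) →
      (Between (f (Sum.inl u)) (f (Sum.inr (Fin.ofNat r k))) (f b) ↔
        Between (f (Sum.inl u)) (f (Sum.inr (Fin.ofNat r k))) (f d)) := by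
    intro t ht b d hb hd
    have hj1 : Fin.ofNat r (k + (t + 1) + 1) ≠ Fin.ofNat r k := hneq (t + 2) ht (by omega)
    have hj2 : Fin.ofNat r (k + (t + 1) + 1) ≠ Fin.ofNat r (k + 1) := by
      rw [show k + (t + 1) + 1 = k + (t + 2) by ring, Ne,
        ofNat_add_left_inj ht (by omega)]
      omega
    have hnr : ∀ b : Fin r ⊕ Fin r, (b = Sum.inl (Fin.ofNat r (k + (t + 1) + 1)) ∨
        b = Sum.inr (Fin.ofNat r (k + (t + 1))) ∨
        b = Sum.inr (Fin.ofNat r (k + (t + 1) + 1))) → b ≠ Sum.inr (Fin.ofNat r k) := by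
      rintro b (rfl | rfl | rfl)
      · simp
      · simpa using hneq (t + 1) (by omega) (by omega)
      · simpa using hj1
    obtain ⟨hb1, hb2⟩ := hspan _ b hb
    obtain ⟨hd1, hd2⟩ := hspan _ d hd
    refine between_star (hf := hf) hM hP hS huv' htri hcl ?_ ?_ (hnr b hb) (hnr d hd) hb1 hd1 hb2 hd2 <;>
      rcases huv with ⟨rfl, rfl⟩ | ⟨rfl, rfl⟩ <;> assumption
  -- Stars of consecutive rim vertices share a rim element, so the comparisons within stars chain
  -- along the rim.
  have hrim : ∀ t, t + 1 < r →
      (Between (f (Sum.inl u)) (f (Sum.inr (Fin.ofNat r k)))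
        (f (Sum.inr (Fin.ofNat r (k + (t + 1))))) ↔
      Between (f (Sum.inl u)) (f (Sum.inr (Fin.ofNat r k)))
        (f (Sum.inr (Fin.ofNat r (k + 1))))) := by
    intro t
    induction t with
    | zero => intro _; rfl
    | succ t ih =>
      intro ht
      rw [← ih (by omega)]
      exact step t (by omega) _ _ (.inr (.inr rfl)) (.inr (.inl rfl))
  rw [show 2 * k + 3 = 2 * (k + 1) + 1 by ring, fanSeq_two_mul_add_one]
  rcases Nat.even_or_odd' m with ⟨l, rfl | rfl⟩
  · obtain ⟨t, rfl⟩ : ∃ t, l = t + 2 := ⟨l - 2, by omega⟩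
    rw [← mul_add, fanSeq_two_mul, ← hrim t (by omega)]
    exact step t (by omega) _ _ (.inl rfl) (.inr (.inl rfl))
  · obtain ⟨t, rfl⟩ : ∃ t, l = t + 1 := ⟨l - 1, by omega⟩
    rw [← add_assoc, ← mul_add, fanSeq_two_mul_add_one]
    exact hrim t (by omega)

end Geometry

/-! ### Consecutive labels are adjacent in the order. -/

section Adjacent

open Set

variable {r : ℕ} [NeZero r] {α : Type*} [LinearOrder α] {M : Matroid (Fin r ⊕ Fin r)}
  {f : Fin r ⊕ Fin r → α} {hf : Function.Injective f}

theorem fanSeq_ne {a b : ℕ} (hab : a < b) (hb : b < a + 2 * r) : fanSeq r a ≠ fanSeq r b := by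
  obtain ⟨m, rfl⟩ := Nat.exists_eq_add_of_lt hab
  have := (fanSeq_add_left_inj (r := r) (a := a) (m := 0) (m' := m + 1)
    (by omega) (by omega)).not.2 (by omega)
  exact this

/-- Only the third element of the triangle, at offset 2, is not covered by `between_outside`. It and
the next rim element do not separate the present pair, by the next triangle, and separation is
symmetric. -/
theorem between_spoke_rim (hM : IsFan M) (hr : 3 ≤ r) (hP : IsPositroid (M.map f hf.injOn))
    (hS : M.IsBase (range Sum.inl)) (k : ℕ) {m : ℕ} (hm2 : 2 ≤ m) (hm : m < 2 * r) :
    Between (f (fanSeq r (2 * k))) (f (fanSeq r (2 * k + 1))) (f (fanSeq r (2 * k + m))) ↔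
      Between (f (fanSeq r (2 * k))) (f (fanSeq r (2 * k + 1))) (f (fanSeq r (2 * k + 3))) := by
  rcases Nat.lt_or_ge m 3 with hlt | hge
  · obtain rfl : m = 2 := by omega
    have hne : ∀ {a b : ℕ}, a < b → b < a + 2 * r → f (fanSeq r a) ≠ f (fanSeq r b) :=
      fun h h' => hf.ne (fanSeq_ne h h')
    refine not_between_cross (hne (by omega) (by omega)) (hne (by omega) (by omega))
      (hne (by omega) (by omega)).symm (hne (by omega) (by omega)) ?_
    have h1 := between_outside (hf := hf) hM hr hP hS (k + 1) (.inl ⟨rfl, rfl⟩)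
      (m := 2 * r - 2) (by omega) (by omega)
    have h2 := between_outside (hf := hf) hM hr hP hS (k + 1) (.inl ⟨rfl, rfl⟩)
      (m := 2 * r - 1) (by omega) (by omega)
    rw [show 2 * (k + 1) + (2 * r - 2) = 2 * k + 2 * r by omega, fanSeq_add_period] at h1
    rw [show 2 * (k + 1) + (2 * r - 1) = 2 * k + 1 + 2 * r by omega, fanSeq_add_period] at h2
    rw [show 2 * k + 2 = 2 * (k + 1) by ring, show 2 * k + 3 = 2 * (k + 1) + 1 by ring,
      fanSeq_two_mul (k + 1), fanSeq_two_mul_add_one (k + 1)]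
    exact h1.trans h2.symm
  · rw [fanSeq_two_mul, fanSeq_two_mul_add_one]
    exact between_outside (hf := hf) hM hr hP hS k (.inl ⟨rfl, rfl⟩) hge hm

/-- The mirror image of `between_spoke_rim`: the third element is at offset `2r` and is treated with
the previous triangle. The index `k + 1` lets that triangle be named `k`. -/
theorem between_rim_spoke (hM : IsFan M) (hr : 3 ≤ r) (hP : IsPositroid (M.map f hf.injOn))
    (hS : M.IsBase (range Sum.inl)) (k : ℕ) {m : ℕ} (hm2 : 3 ≤ m) (hm : m ≤ 2 * r) :
    Between (f (fanSeq r (2 * (k + 1) + 2))) (f (fanSeq r (2 * (k + 1) + 1)))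
        (f (fanSeq r (2 * (k + 1) + m))) ↔
      Between (f (fanSeq r (2 * (k + 1) + 2))) (f (fanSeq r (2 * (k + 1) + 1)))
        (f (fanSeq r (2 * (k + 1) + 3))) := by
  have hout : ∀ {m : ℕ}, 3 ≤ m → m < 2 * r →
      (Between (f (fanSeq r (2 * (k + 1) + 2))) (f (fanSeq r (2 * (k + 1) + 1)))
        (f (fanSeq r (2 * (k + 1) + m))) ↔
      Between (f (fanSeq r (2 * (k + 1) + 2))) (f (fanSeq r (2 * (k + 1) + 1)))
        (f (fanSeq r (2 * (k + 1) + 3)))) := by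
    intro m hm3 hm
    rw [show 2 * (k + 1) + 2 = 2 * (k + 1 + 1) by ring, fanSeq_two_mul (k + 1 + 1),
      fanSeq_two_mul_add_one (k + 1)]
    exact between_outside (hf := hf) hM hr hP hS (k + 1) (.inr ⟨rfl, rfl⟩) hm3 hm
  rcases Nat.lt_or_ge m (2 * r) with hlt | hge
  · exact hout hm2 hlt
  · obtain rfl : m = 2 * r := by omega
    have hne : ∀ {a b : ℕ}, a < b → b < a + 2 * r → f (fanSeq r a) ≠ f (fanSeq r b) :=
      fun h h' => hf.ne (fanSeq_ne h h')
    rw [← hout (m := 2 * r - 1) (by omega) (by omega), fanSeq_add_period,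
      show 2 * (k + 1) + (2 * r - 1) = 2 * k + 1 + 2 * r by omega, fanSeq_add_period]
    refine not_between_cross (hne (by omega) (by omega)).symm (hne (by omega) (by omega)).symm
      (hne (by omega) (by omega)) (hne (by omega) (by omega)).symm ?_
    have h1 := between_outside (hf := hf) hM hr hP hS k (.inr ⟨rfl, rfl⟩)
      (m := 4) (by omega) (by omega)
    rw [fanSeq_two_mul, fanSeq_two_mul_add_one]
    exact h1

theorem between_consecutive (hM : IsFan M) (hr : 3 ≤ r) (hP : IsPositroid (M.map f hf.injOn))
    (hS : M.IsBase (range Sum.inl)) (k : ℕ) {x y : Fin r ⊕ Fin r}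
    (hx : x ≠ fanSeq r k) (hx' : x ≠ fanSeq r (k + 1))
    (hy : y ≠ fanSeq r k) (hy' : y ≠ fanSeq r (k + 1)) :
    Between (f (fanSeq r k)) (f (fanSeq r (k + 1))) (f x) ↔
      Between (f (fanSeq r k)) (f (fanSeq r (k + 1))) (f y) := by
  have key : ∀ x, x ≠ fanSeq r k → x ≠ fanSeq r (k + 1) →
      (Between (f (fanSeq r k)) (f (fanSeq r (k + 1))) (f x) ↔
      Between (f (fanSeq r k)) (f (fanSeq r (k + 1))) (f (fanSeq r (k + 2 + (k + 1) % 2)))) := by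
    intro x hx hx'
    obtain ⟨m, hm, rfl⟩ := exists_fanSeq_add k x
    have hm0 : m ≠ 0 := by rintro rfl; exact hx rfl
    have hm1 : m ≠ 1 := by rintro rfl; exact hx' rfl
    rcases Nat.even_or_odd' k with ⟨l, rfl | rfl⟩
    · rw [show 2 * l + 2 + (2 * l + 1) % 2 = 2 * l + 3 by omega]
      exact between_spoke_rim (hf := hf) hM hr hP hS l (by omega) hm
    -- The index is raised by a full period so that a predecessor exists in the natural numbers.
    · have h := between_rim_spoke (hf := hf) hM hr hP hS (l + r - 1) (m := m + 1)
        (by omega) (by omega)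
      rw [show l + r - 1 + 1 = l + r by omega,
        show 2 * (l + r) + 1 = 2 * l + 1 + 2 * r by ring,
        show 2 * (l + r) + 2 = 2 * l + 1 + 1 + 2 * r by ring,
        show 2 * (l + r) + 3 = 2 * l + 1 + 2 + (2 * l + 1 + 1) % 2 + 2 * r by omega,
        show 2 * (l + r) + (m + 1) = 2 * l + 1 + m + 2 * r by ring,
        fanSeq_add_period, fanSeq_add_period, fanSeq_add_period, fanSeq_add_period] at h
      rw [Between.symm_iff, h, Between.symm_iff]
  rw [key x hx hx', key y hy hy']

/-- A permutation of the labels can be moved from the matroid into the labelling. -/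
theorem map_mapEquiv_symm {β γ : Type*} (M : Matroid β) (e : Equiv.Perm β) {f : β → γ}
    (hf : Function.Injective f) :
    (M.mapEquiv e.symm).map (f ∘ e) (hf.comp e.injective).injOn = M.map f hf.injOn := by
  refine Matroid.ext_isBase ?_ fun B _ => ?_
  · simp [image_image]
  · simp only [Matroid.map_isBase_iff, Matroid.mapEquiv_isBase_iff, Equiv.symm_symm]
    constructor
    · rintro ⟨B₀, h, rfl⟩
      exact ⟨_, h, by rw [image_image]; rfl⟩
    · rintro ⟨B₀, h, rfl⟩
      refine ⟨e.symm '' B₀, by simpa using h, by simp [image_image]⟩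

/-- A positroid isomorphic to a whirl of rank at least three is ordered, up to a reflection, like
the whirl. -/
theorem exists_isCyclicLabelling_of_three_le (hM : IsFan M) (hr : 3 ≤ r)
    (hP : IsPositroid (M.map f hf.injOn)) (hS : M.IsBase (range Sum.inl)) :
    ∃ e : Equiv.Perm (Fin r ⊕ Fin r), IsFan (M.mapEquiv e.symm) ∧ IsCyclicLabelling (f ∘ e) := by
  obtain ⟨u, hu, hlt, hsurj⟩ := exists_position hf
  have hub : ∀ x y z, Between (f x) (f y) (f z) ↔ Between (u x) (u y) (u z) := by
    intro x y z
    unfold Between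
    rw [hu, hu, hu, hu]
  have hadj : ∀ k, CycSucc (2 * r) (u (fanSeq r k)) (u (fanSeq r (k + 1))) ∨
      CycSucc (2 * r) (u (fanSeq r (k + 1))) (u (fanSeq r k)) := by
    intro k
    have hinj : ∀ x y, u x = u y → x = y := fun x y h => by
      by_contra hne
      rcases lt_or_gt_of_ne (hf.ne hne) with h' | h'
      · exact absurd h ((hu _ _).1 h').ne
      · exact absurd h ((hu _ _).1 h').ne'
    refine cycSucc_or_of_between (hlt _) (hlt _)
      (fun h => fanSeq_ne (by omega) (by omega) (hinj _ _ h)) ?_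
    intro s t hs ht hs1 hs2 ht1 ht2
    obtain ⟨x, rfl⟩ := hsurj s hs
    obtain ⟨y, rfl⟩ := hsurj t ht
    rw [← hub, ← hub]
    exact between_consecutive (hf := hf) hM hr hP hS k (fun h => hs1 (h ▸ rfl))
      (fun h => hs2 (h ▸ rfl)) (fun h => ht1 (h ▸ rfl)) (fun h => ht2 (h ▸ rfl))
  have hne : ∀ k, u (fanSeq r k) ≠ u (fanSeq r (k + 2)) := by
    intro k h
    rcases lt_or_gt_of_ne (hf.ne (fanSeq_ne (r := r) (a := k) (b := k + 2)
      (by omega) (by omega))) with h' | h'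
    · exact absurd h ((hu _ _).1 h').ne
    · exact absurd h ((hu _ _).1 h').ne'
  rcases cycSucc_direction (fun k => hlt (fanSeq r k)) hadj hne with h | h
  · refine ⟨Equiv.refl _, by convert hM; ext <;> simp, isCyclicLabelling_of_cycSucc hu hlt h⟩
  -- The labels run backwards; reflecting them reverses the direction and preserves `IsFan`.
  · refine ⟨fanReflectEquiv, hM.mapEquiv_fanReflect,
      isCyclicLabelling_of_cycSucc (u := u ∘ fanReflect) (fun x y => hu _ _) (fun x => hlt _) ?_⟩
    intro k
    simp only [Function.comp_apply]
    rw [fanReflect_add k 1 (by omega), fanReflect_fanSeq]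
    have := h ((2 * r - 1) * k + (2 * r - 1))
    rwa [show (2 * r - 1) * k + (2 * r - 1) + 1 = (2 * r - 1) * k + 2 * r by omega,
      fanSeq_add_period] at this

end Adjacent

/-! ### The envelope class and the main theorem. -/

section Main

open Set

/-- The whirl of rank 2 is uniform on four elements, so every relabelling of it is again a fan
matroid and positivity puts no constraint on its order. -/
theorem whirl_two_isBase_iff (B : Set (Fin 2 ⊕ Fin 2)) :
    (whirl 2).IsBase B ↔ B.encard = 2 := by
  have hW := isFan_whirl (le_refl 2)
  refine ⟨fun h => hW.encard_eq le_rfl h, fun h => ?_⟩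
  by_cases hrim : B = rim 2
  · exact (whirl_isBase_iff (by omega) B).2 (.inr hrim)
  obtain ⟨i, hi⟩ := exists_spoke_mem h hrim
  obtain ⟨x, y, hxy, rfl⟩ := encard_eq_two.1 h
  have key : ∀ (i : Fin 2) (y : Fin 2 ⊕ Fin 2), Sum.inl i ≠ y →
      (whirl 2).Indep {Sum.inl i, y} := by
    rintro i (j | j) hij
    · exact indep_spokes_whirl (by omega) (by simpa using hij)
    · exact hW.indep_spoke_rim le_rfl i j
  have hI : (whirl 2).Indep {x, y} := by
    rcases hi with rfl | rfl
    · exact key _ _ hxy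
    · rw [pair_comm]
      exact key _ _ hxy.symm
  obtain ⟨B, hB, hsub⟩ := hI.exists_isBase_superset
  have := (toFinite _).eq_of_subset_of_encard_le hsub (by rw [hW.encard_eq le_rfl hB, h]; rfl)
  exact this ▸ hB

theorem isFan_of_isBase_iff_encard_eq_two {N : Matroid (Fin 2 ⊕ Fin 2)} (hE : N.E = univ)
    (hN : ∀ B, N.IsBase B ↔ B.encard = 2) : IsFan N where
  ground := hE
  not_indep_tri i hI := by
    obtain ⟨B, hB, hsub⟩ := hI.exists_isBase_superset
    have h1 := encard_le_encard hsub
    rw [(hN B).1 hB, encard_insert_of_notMem (by simp), encard_pair (by simp)] at h1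
    exact absurd h1 (by decide)
  isBase i j := by
    rw [hN, encard_insert_rim_sdiff]
    rfl

variable {r : ℕ} {α : Type*} [LinearOrder α]

theorem exists_isCyclicLabelling_perm [NeZero r] {f : Fin r ⊕ Fin r → α}
    (hf : Function.Injective f) : ∃ e : Equiv.Perm (Fin r ⊕ Fin r), IsCyclicLabelling (f ∘ e) := by
  obtain ⟨u, hu, hlt, hsurj⟩ := exists_position hf
  choose e he using fun x : Fin r ⊕ Fin r => hsurj (fanIndex x) (fanIndex_lt x)
  have hinj : Function.Injective e := fun x y h => by
    rw [← fanSeq_fanIndex x, ← fanSeq_fanIndex y, ← he, ← he, h]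
  refine ⟨Equiv.ofBijective e (Finite.injective_iff_bijective.1 hinj),
    isCyclicLabelling_of_cycSucc (u := u ∘ e) (fun x y => hu _ _) (fun x => hlt _) fun k => ?_⟩
  have hidx : ∀ k, fanIndex (fanSeq r k) = k % (2 * r) := by
    intro k
    have := fanSeq_eq_iff.1 (fanSeq_fanIndex (fanSeq r k))
    rwa [Nat.mod_eq_of_lt (fanIndex_lt _)] at this
  simp only [Function.comp_apply, he, hidx, CycSucc]
  have hr : 0 < r := Nat.pos_of_ne_zero (NeZero.ne r)
  have h1 : k % (2 * r) < 2 * r := Nat.mod_lt _ (by omega)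
  rcases Nat.lt_or_ge (k % (2 * r) + 1) (2 * r) with h | h
  · left
    rw [Nat.add_mod, Nat.mod_eq_of_lt (a := 1) (by omega), Nat.mod_eq_of_lt h]
  · right
    have h2 : k % (2 * r) + 1 = 2 * r := by omega
    refine ⟨h2, ?_⟩
    rw [Nat.add_mod, Nat.mod_eq_of_lt (a := 1) (by omega), h2, Nat.mod_self]

/-- A positroid isomorphic to a whirl can be labelled in the order of the whirl. -/
theorem exists_isCyclicLabelling [NeZero r] {P : Matroid α} (hP : IsPositroid P) (hr : 2 ≤ r)
    (hPW : MatroidIso P (whirl r)) :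
    ∃ (f : Fin r ⊕ Fin r → α) (hf : Function.Injective f) (N : Matroid (Fin r ⊕ Fin r)),
      IsFan N ∧ IsCyclicLabelling f ∧ P = N.map f hf.injOn := by
  obtain ⟨f, hf, rfl⟩ := exists_equiv_of_matroidIso rfl hPW
  obtain ⟨e, he, hl⟩ : ∃ e : Equiv.Perm (Fin r ⊕ Fin r), IsFan ((whirl r).mapEquiv e.symm) ∧
      IsCyclicLabelling (f ∘ e) := by
    have hW := isFan_whirl hr
    rcases Nat.lt_or_ge r 3 with hlt | hge
    · obtain rfl : r = 2 := by omega
      obtain ⟨e, he⟩ := exists_isCyclicLabelling_perm hf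
      refine ⟨e, isFan_of_isBase_iff_encard_eq_two (by simp [hW.ground]) fun B => ?_, he⟩
      rw [mapEquiv_isBase_iff', whirl_two_isBase_iff, e.injective.encard_image]
    · have i : Fin r := ⟨0, by omega⟩
      have hi := (finRotate_ne_self hr i).symm
      exact exists_isCyclicLabelling_of_three_le (hf := hf) hW hge hP
        (hW.isBase_spokes hr (indep_spokes_whirl (by omega) hi) hi)
  exact ⟨f ∘ e, hf.comp e.injective, _, he, hl, (map_mapEquiv_symm _ e hf).symm⟩

/-- In a cyclic labelling, the elements preceding a given one in a shifted order form an interval of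
labels, so the greedy description becomes a statement about intervals. -/
theorem mem_necklace_map_iff [NeZero r] {f : Fin r ⊕ Fin r → α} (hf : Function.Injective f)
    (hl : IsCyclicLabelling f) {N : Matroid (Fin r ⊕ Fin r)} (hN : N.E = univ)
    {a m : ℕ} (hm : m < 2 * r) :
    f (fanSeq r (a + m)) ∈ necklace (N.map f hf.injOn) (f (fanSeq r a)) ↔
      fanSeq r (a + m) ∉ N.closure (fanSeq r '' Ico a (a + m)) := by
  have hE : (N.map f hf.injOn).E = range f := by
    rw [Matroid.map_ground, hN, image_univ]
  rw [mem_necklace_iff (by rw [hE]; exact finite_range f), hE, hl a m hm, Matroid.map_closure_eq,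
    hf.mem_set_image, preimage_image_eq _ hf]
  simp

theorem necklace_subset_ground {M : Matroid α} (hM : M.E.Finite) (i : α) :
    necklace M i ⊆ M.E := fun x hx => ((mem_necklace_iff hM i x).1 hx).1

/-- The envelope class of a cyclically labelled matroid satisfying `IsFan` consists of all
matroids satisfying `IsFan` with the same labelling. -/
theorem map_mem_envelopeClass_iff [NeZero r] (hr : 2 ≤ r) {f : Fin r ⊕ Fin r → α}
    (hf : Function.Injective f) (hl : IsCyclicLabelling f) {N N' : Matroid (Fin r ⊕ Fin r)}
    (hN : IsFan N) (hN' : N'.E = univ) :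
    N'.map f hf.injOn ∈ envelopeClass (N.map f hf.injOn) ↔ IsFan N' := by
  have hE : ∀ {N : Matroid (Fin r ⊕ Fin r)}, N.E = univ → (N.map f hf.injOn).E = range f :=
    fun h => by rw [Matroid.map_ground, h, image_univ]
  constructor
  · rintro ⟨-, h⟩
    -- The right-hand side of the pattern does not mention the matroid, so `N'` inherits it from `N`
    -- through the equality of necklaces.
    refine HasFanPattern.isFan (fun a m hm => ?_) hN' hr
    have h1 := h (f (fanSeq r a)) (by rw [hE hN.ground]; exact mem_range_self _)
    rw [← hN.hasFanPattern hr a m hm, ← not_iff_not, ← mem_necklace_map_iff hf hl hN' hm,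
      ← mem_necklace_map_iff hf hl hN.ground hm, h1]
  · intro h
    refine ⟨(hE hN').trans (hE hN.ground).symm, fun i hi => ?_⟩
    rw [hE hN.ground] at hi
    obtain ⟨x, rfl⟩ := hi
    obtain ⟨a, -, rfl⟩ := exists_fanSeq_add 0 x
    ext y
    by_cases hy : y ∈ range f
    · obtain ⟨z, rfl⟩ := hy
      obtain ⟨m, hm, rfl⟩ := exists_fanSeq_add (0 + a) z
      rw [mem_necklace_map_iff hf hl hN' hm, mem_necklace_map_iff hf hl hN.ground hm,
        h.hasFanPattern hr _ m hm, hN.hasFanPattern hr _ m hm]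
    · have hno : ∀ {N : Matroid (Fin r ⊕ Fin r)}, N.E = univ →
          y ∉ necklace (N.map f hf.injOn) (f (fanSeq r (0 + a))) := fun hN h =>
        hy (hE hN ▸ necklace_subset_ground (by rw [hE hN]; exact finite_range f) _ h)
      exact iff_of_false (hno hN') (hno hN.ground)

end Main

theorem mainTheorem2 {α : Type*} [LinearOrder α] (P : Matroid α) (hP : IsPositroid P)
    (r : ℕ) (hr : 2 ≤ r) (hPW : MatroidIso P (whirl r)) :
    (∃ φ : Fin 4 ≃ envelopeClass P, ∀ j : Fin 4,
      MatroidIso (φ j : Matroid α)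
        (![cycleMatroid (graphN r), relaxedN r, cycleMatroid (wheelGraph r), whirl r] j)) ∧
    (3 ≤ r → ∀ j k : Fin 4,
      MatroidIso
        (![cycleMatroid (graphN r), relaxedN r, cycleMatroid (wheelGraph r), whirl r] j)
        (![cycleMatroid (graphN r), relaxedN r, cycleMatroid (wheelGraph r), whirl r] k) →
      j = k) := by
  refine ⟨?_, fun h3 j k h => eq_of_matroidIso_fanMatroid h3 j k h⟩
  have : NeZero r := ⟨by omega⟩
  obtain ⟨f, hf, N, hN, hl, rfl⟩ := exists_isCyclicLabelling hP hr hPW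
  let φ : Fin 4 → envelopeClass (N.map f hf.injOn) := fun j =>
    ⟨(fanMatroid r j).map f hf.injOn,
      (map_mem_envelopeClass_iff hr hf hl hN (isFan_fanMatroid hr j).ground).2
        (isFan_fanMatroid hr j)⟩
  have hφ : Function.Bijective φ := by
    constructor
    · intro j k h
      have h' := congrArg (fun M : Matroid α => M.comap f) (congrArg Subtype.val h)
      simp only [φ, Matroid.comap_map hf] at h'
      exact fanMatroid_injective hr h'
    · rintro ⟨M, hM⟩
      have hME : M.E = Set.range f := by
        rw [hM.1, Matroid.map_ground, hN.ground, Set.image_univ]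
      -- Every member of the class has ground set `Set.range f`, hence is the image of its pullback
      -- to the labels, which can then be classified.
      have hmap : (M.comap f).map f hf.injOn = M :=
        Matroid.map_comap hME.le hf.injOn
      have hE : (M.comap f).E = Set.univ := by
        rw [Matroid.comap_ground_eq, hME, Set.preimage_range]
      have hfan : IsFan (M.comap f) :=
        (map_mem_envelopeClass_iff hr hf hl hN hE).1 (by rw [hmap]; exact hM)
      obtain ⟨k, hk⟩ := hfan.exists_eq_fanMatroid hr
      refine ⟨k, Subtype.ext ?_⟩
      change (fanMatroid r k).map f hf.injOn = M
      rw [← hmap]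
      simp only [hk]
  exact ⟨Equiv.ofBijective φ hφ, fun j => matroidIso_map f hf⟩
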